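/- Let $\mathfrak Q=\langle Q,\mathcal L\rangle$ be a (nondegenerate, Buekenhout–Shult) polar space of index $m$: a partial linear space with at least three points on every line, in which a point off a line $L$ is collinear with exactly one or with all points of $L$, no point is collinear with all points, and $m$ is the largest projective dimension of a strong subspace (a subspace whose points are pairwise collinear). Let $\wp_d(\mathfrak Q)$ be the set of its $d$-dimensional strong subspaces ($\wp_{-1}(\mathfrak Q)=\{\emptyset\}$). Let $\mathcal H$ be a hyperplane of $\mathfrak Q$, i.e. a proper subspace meeting every line, and let $\mathfrak U$ be the affine polar space with point set $Q\setminus\mathcal H$ and lines the nonempty sets $L\setminus\mathcal H$, $L\in\mathcal L$. For $d\ge 0$ put $\wp_d(\mathfrak U)=\{X\setminus\mathcal H: X\in\wp_d(\mathfrak Q),\ X\not\subset\mathcal H\}$, and $\wp_{-1}(\mathfrak U)=\{\emptyset\}$. For $0\le k<m$ let $\mathbf P_k(\mathfrak U)$ be the point-line structure with point set $\wp_k(\mathfrak U)$ whose lines are the pencils $\{A\in\wp_k(\mathfrak U): C\subset A\subset B\}$ with $C\in\wp_{k-1}(\mathfrak U)$, $B\in\wp_{k+1}(\mathfrak U)$,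 $C\subset B$; and let $\mathbf P^\dagger_k(\mathfrak U)$ be the point-line structure with the same points whose lines are the nonempty sets $\{X\setminus\mathcal H: X\in\wp_k(\mathfrak Q),\ C\subset X\subset B,\ X\not\subset\mathcal H\}$ with $C\in\wp_{k-1}(\mathfrak Q)$, $B\in\wp_{k+1}(\mathfrak Q)$, $C\subset B$. Then for all $0\le k<m$ the affine polar space $\mathfrak U$ is definable both in $\mathbf P_k(\mathfrak U)$ and in $\mathbf P^\dagger_k(\mathfrak U)$, in the following sense. For each of the two structures there are first-order formulas without parameters in the language of its ternary collinearity relation ("some line contains $a,b,c$"), depending only on $k$ and $m$, such that for every polar space $\mathfrak Q$ of index $m$ and every hyperplane $\mathcal H$ of it the points of $\mathfrak U$ and the lines of $\mathfrak U$ can be identified with classes of tuples of elements of $\wp_k(\mathfrak U)$ in such a way that the following are given by these formulas: which tuples represent points and which represent lines, when two tuples represent the same point, when a point lies on a line, and when a point of $\mathfrak U$ lies on an element of $\wp_k(\mathfrak U)$. -/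

import Mathlib

/-- A (nondegenerate) polar space in the sense of Buekenhout and Shult: a partial linear space
with at least three points on every line, satisfying the one-or-all axiom, and in which no point
is collinear with all points. -/
structure PolarSpace (Q : Type*) where
  lines : Set (Set Q)
  three_le_card : ∀ L ∈ lines, 3 ≤ L.encard
  unique_line : ∀ L ∈ lines, ∀ L' ∈ lines, ∀ a b : Q,
    a ≠ b → a ∈ L → b ∈ L → a ∈ L' → b ∈ L' → L = L'
  one_or_all : ∀ L ∈ lines, ∀ a : Q, a ∉ L →
    (∃! b, b ∈ L ∧ ∃ M ∈ lines, a ∈ M ∧ b ∈ M) ∨ (∀ b ∈ L, ∃ M ∈ lines, a ∈ M ∧ b ∈ M)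
  nondegenerate : ∀ a : Q, ∃ b : Q, b ≠ a ∧ ¬ ∃ M ∈ lines, a ∈ M ∧ b ∈ M

namespace PolarSpace

variable {Q : Type*} (𝔔 : PolarSpace Q)

/-- `a ⊥ b`: the points `a`, `b` are collinear (every point is collinear with itself). -/
def Perp (a b : Q) : Prop := a = b ∨ ∃ L ∈ 𝔔.lines, a ∈ L ∧ b ∈ L

/-- A subspace contains every line with which it shares two distinct points. -/
def IsSubspace (X : Set Q) : Prop :=
  ∀ L ∈ 𝔔.lines, ∀ a b : Q, a ≠ b → a ∈ L → b ∈ L → a ∈ X → b ∈ X → L ⊆ X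

/-- A strong (singular) subspace: any two of its points are collinear. -/
def IsStrong (X : Set Q) : Prop :=
  𝔔.IsSubspace X ∧ ∀ a ∈ X, ∀ b ∈ X, 𝔔.Perp a b

/-- The strong subspaces, ordered by inclusion. -/
abbrev Strong : Type _ := {X : Set Q // 𝔔.IsStrong X}

/-- `sub d` is the family of the strong subspaces of (projective) dimension `d`. The height of `X`
is the largest length of a chain of strong subspaces ascending to `X`, that is, one more than the
projective dimension: `0` for the empty set, `1` for a point, `2` for a line. -/
def sub (d : ℤ) : Set (Set Q) :=
  {X | ∃ (h : 𝔔.IsStrong X) (n : ℕ), Order.height (⟨X, h⟩ : 𝔔.Strong) = n ∧ (n : ℤ) = d + 1}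

/-- The space has index `m`: the maximal dimension of its strong subspaces is `m`. -/
def HasIndex (m : ℕ) : Prop :=
  (𝔔.sub m).Nonempty ∧ ∀ X : 𝔔.Strong, Order.height X ≤ ((m + 1 : ℕ) : ℕ∞)

/-- A (geometric) hyperplane: a proper subspace that meets every line. -/
def IsHyperplane (H : Set Q) : Prop :=
  𝔔.IsSubspace H ∧ H ≠ Set.univ ∧ ∀ L ∈ 𝔔.lines, (L ∩ H).Nonempty

/-- `p(C, B)`: the `k`-dimensional strong subspaces between `C` and `B`. -/
def pencil (k : ℕ) (C B : Set Q) : Set (Set Q) := {X | X ∈ 𝔔.sub k ∧ C ⊆ X ∧ X ⊆ B}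

/-- The `k`-pencils of the polar space. -/
def pencils (k : ℕ) : Set (Set (Set Q)) :=
  {p | ∃ C ∈ 𝔔.sub ((k : ℤ) - 1), ∃ B ∈ 𝔔.sub ((k : ℤ) + 1), C ⊆ B ∧ p = 𝔔.pencil k C B}

/-- The lines of the affine polar space, whose point set is `Hᶜ`: the nonempty traces of the lines
of the polar space. -/
def affLines (H : Set Q) : Set (Set ↥(Hᶜ)) :=
  {l | l.Nonempty ∧ ∃ L ∈ 𝔔.lines, l = Subtype.val ⁻¹' L}

/-- The strong subspaces of dimension `d` of the affine polar space: the sets `X \ H` for strong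
`d`-dimensional `X` not contained in `H`. The empty set is the only one of dimension `-1`. -/
def affSub (H : Set Q) (d : ℤ) : Set (Set Q) :=
  {A | ∃ X ∈ 𝔔.sub d, (d = -1 ∨ ¬ X ⊆ H) ∧ A = X \ H}

/-- The lines of the space of `k`-pencils over the affine polar space. -/
def affPencils (H : Set Q) (k : ℕ) : Set (Set ↥(𝔔.affSub H k)) :=
  {p | ∃ C ∈ 𝔔.affSub H ((k : ℤ) - 1), ∃ B ∈ 𝔔.affSub H ((k : ℤ) + 1), C ⊆ B ∧
    p = {A | C ⊆ A.1 ∧ A.1 ⊆ B}}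

/-- The lines of the extended space of `k`-pencils over the affine polar space: the nonempty traces
of all `k`-pencils of the polar space. -/
def affPencilsExt (H : Set Q) (k : ℕ) : Set (Set ↥(𝔔.affSub H k)) :=
  {p | p.Nonempty ∧ ∃ q ∈ 𝔔.pencils k, p = {A | ∃ X ∈ q, ¬ X ⊆ H ∧ A.1 = X \ H}}

end PolarSpace

/-- The relation symbols of the language of collinearity: one ternary symbol. -/
inductive CollinearityRel : ℕ → Type
  | col : CollinearityRel 3

/-- The first-order language of collinearity (no parameters, one ternary relation). -/
abbrev collinearityLang : FirstOrder.Language.{0, 0} := ⟨fun _ => Empty, CollinearityRel⟩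

/-- A point-line structure as a first-order structure: `col a b c` means that some line contains
`a`, `b` and `c` (which need not be distinct). -/
abbrev collinearityStructure {S : Type*} (𝓛 : Set (Set S)) : collinearityLang.Structure S where
  funMap := fun f => f.elim
  RelMap := fun {_} r => match r with
    | .col => fun x => ∃ l ∈ 𝓛, x 0 ∈ l ∧ x 1 ∈ l ∧ x 2 ∈ l

/-- Truth of a first-order formula in the point-line structure with lines `𝓛`. -/
def HoldsIn {S : Type*} (𝓛 : Set (Set S)) {α : Type*} (φ : collinearityLang.Formula α)
    (v : α → S) : Prop :=
  @FirstOrder.Language.Formula.Realize collinearityLang S (collinearityStructure 𝓛) α φ v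

/-- The formulas, without parameters, that make up a definition of one point-line structure in
another: which tuples represent points, when two of them represent the same point, which tuples
represent lines, when a point lies on a line, and when a point lies on an element of the defining
structure. -/
structure DefinitionScheme where
  n : ℕ
  r : ℕ
  isPoint : collinearityLang.Formula (Fin n)
  samePoint : collinearityLang.Formula (Fin n ⊕ Fin n)
  isLine : collinearityLang.Formula (Fin r)
  onLine : collinearityLang.Formula (Fin n ⊕ Fin r)
  onElement : collinearityLang.Formula (Fin n ⊕ Fin 1)

/-- The scheme `σ` defines the point-line structure `⟨P, 𝓖⟩` in the point-line structure `⟨S, 𝓛⟩`,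
where `inc` is the incidence between `P` and `S`: points and lines of the former are identified
with classes of tuples of elements of the latter (through the surjections `f` and `g`), and under
this identification equality of points, incidence of points and lines, and `inc` are given by the
formulas of `σ`. -/
def DefinitionScheme.Defines (σ : DefinitionScheme) {P S : Type*} (𝓖 : Set (Set P))
    (𝓛 : Set (Set S)) (inc : P → S → Prop) : Prop :=
  ∃ (f : {x : Fin σ.n → S // HoldsIn 𝓛 σ.isPoint x} → P)
    (g : {y : Fin σ.r → S // HoldsIn 𝓛 σ.isLine y} → 𝓖),
    Function.Surjective f ∧ Function.Surjective g ∧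
    (∀ x x', f x = f x' ↔ HoldsIn 𝓛 σ.samePoint (Sum.elim x.1 x'.1)) ∧
    (∀ x y, f x ∈ (g y).1 ↔ HoldsIn 𝓛 σ.onLine (Sum.elim x.1 y.1)) ∧
    (∀ x A, inc (f x) A ↔ HoldsIn 𝓛 σ.onElement (Sum.elim x.1 (fun _ : Fin 1 => A)))

/-! The dimension of the elements is lowered one step at a time until points are reached. Strong
subspaces are handled by their rank, projective dimension plus one, so `El H n` consists of the
strong subspaces of rank `n + 1` not inside `H`. On it there are two collinearities: `affCol`, whose
pencils have a bottom outside `H`, and `affColExt`, where the bottom may lie in `H`. In dimension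
`0` the relation `affColExt` is collinearity of the affine polar space itself.

Two definability results make up a descent step. In positive dimension `affCol` is definable from
`affColExt`: two intersecting extended lines span a configuration in which a Veblen-type axiom holds
when the bottom is outside `H`, and fails for a suitable choice when the bottom is inside `H`, since
the required meeting element then lies in `H`. So the proper lines are those without a parallel
(`properCol_iff`).

Secondly, `affCol` on rank `n + 2` defines `affColExt` on rank `n + 1` (`exists_isPairCoding`). A
subspace `C` outside `H` is coded as `X ∩ Y`, where `X` and `Y` contain `C` with corank one and are
not mutually collinear. Such pairs are recognised by `Share` (`share_of_subset`,
`Share.exists_base`), the elements above `C` by `Contains` (`contains_iff`), and pencils of coded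
subspaces by cutting a line of elements with one more element (`stepCol_iff`). All pencils, even
those with bottom in `H`, arise in this way, because their bottom can be enlarged by a point outside
`H`. This is why the extended structure appears one dimension lower, and why the first result is
needed before the next descent.

The geometric input is that of polar spaces of finite rank: a point collinear with a strong subspace
but outside it can be separated from it (`exists_separating`), which gives strong subspaces the
dimension arithmetic of projective spaces (`Rk.join`) and shows that all strong subspaces below the
top rank can be extended (`Rk.exists_mem_orth`). The logical input is that a coding by pairs
translates formulas to formulas uniformly (`exists_translation`, `DefinitionScheme.exists_comp`). -/

namespace PolarSpace

/-! ### Polar spaces: separation of points, joins and ranks of strong subspaces -/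

variable {Q : Type*} {𝔔 : PolarSpace Q}

variable (𝔔) in
/-- Some line contains `a`, `b` and `c`. -/
def Col (a b c : Q) : Prop := ∃ L ∈ 𝔔.lines, a ∈ L ∧ b ∈ L ∧ c ∈ L

theorem Perp.refl (a : Q) : 𝔔.Perp a a := Or.inl rfl

theorem Perp.symm {a b : Q} (h : 𝔔.Perp a b) : 𝔔.Perp b a := by
  rcases h with h | ⟨L, hL, h1, h2⟩
  · exact Or.inl h.symm
  · exact Or.inr ⟨L, hL, h2, h1⟩

theorem Col.perp {a b c : Q} (h : 𝔔.Col a b c) : 𝔔.Perp a c :=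
  let ⟨L, hL, h1, _, h3⟩ := h; Or.inr ⟨L, hL, h1, h3⟩

theorem Col.rot {a b c : Q} (h : 𝔔.Col a b c) : 𝔔.Col b c a :=
  let ⟨L, hL, h1, h2, h3⟩ := h; ⟨L, hL, h2, h3, h1⟩

theorem Col.swap {a b c : Q} (h : 𝔔.Col a b c) : 𝔔.Col b a c :=
  let ⟨L, hL, h1, h2, h3⟩ := h; ⟨L, hL, h2, h1, h3⟩

theorem Col.swap' {a b c : Q} (h : 𝔔.Col a b c) : 𝔔.Col a c b :=
  let ⟨L, hL, h1, h2, h3⟩ := h; ⟨L, hL, h1, h3, h2⟩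

theorem IsSubspace.col {X : Set Q} (hX : 𝔔.IsSubspace X) {a b c : Q} (ha : a ∈ X) (hb : b ∈ X)
    (hab : a ≠ b) (h : 𝔔.Col a b c) : c ∈ X :=
  let ⟨L, hL, h1, h2, h3⟩ := h; hX L hL a b hab h1 h2 ha hb h3

theorem perp_of_line {L : Set Q} (hL : L ∈ 𝔔.lines) {p a b c : Q} (ha : a ∈ L) (hb : b ∈ L)
    (hc : c ∈ L) (hab : a ≠ b) (hpa : 𝔔.Perp p a) (hpb : 𝔔.Perp p b) : 𝔔.Perp p c := by
  by_cases hp : p ∈ L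
  · exact Or.inr ⟨L, hL, hp, hc⟩
  have key : ∀ x, x ∈ L → 𝔔.Perp p x → ∃ M ∈ 𝔔.lines, p ∈ M ∧ x ∈ M := by
    rintro x hx (rfl | h)
    · exact absurd hx hp
    · exact h
  rcases 𝔔.one_or_all L hL p hp with ⟨x, -, hx⟩ | h
  · exact absurd ((hx a ⟨ha, key a ha hpa⟩).trans (hx b ⟨hb, key b hb hpb⟩).symm) hab
  · exact Or.inr (h c hc)

theorem exists_perp_of_line {L : Set Q} (hL : L ∈ 𝔔.lines) (p : Q) : ∃ c ∈ L, 𝔔.Perp p c := by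
  by_cases hp : p ∈ L
  · exact ⟨p, hp, Perp.refl p⟩
  rcases 𝔔.one_or_all L hL p hp with ⟨x, ⟨hx, h⟩, -⟩ | h
  · exact ⟨x, hx, Or.inr h⟩
  · have h3 := 𝔔.three_le_card L hL
    have : L.Nonempty := by
      rw [← Set.encard_pos]; exact lt_of_lt_of_le (by norm_num) h3
    obtain ⟨x, hx⟩ := this
    exact ⟨x, hx, Or.inr (h x hx)⟩

theorem perp_of_col {p a b c : Q} (h : 𝔔.Col a b c) (hab : a ≠ b) (hpa : 𝔔.Perp p a)
    (hpb : 𝔔.Perp p b) : 𝔔.Perp p c :=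
  let ⟨_, hL, h1, h2, h3⟩ := h; perp_of_line hL h1 h2 h3 hab hpa hpb

theorem exists_col_perp {a b : Q} (h : 𝔔.Perp a b) (hab : a ≠ b) (p : Q) :
    ∃ c, 𝔔.Col a b c ∧ 𝔔.Perp p c := by
  obtain ⟨L, hL, ha, hb⟩ := h.resolve_left hab
  obtain ⟨c, hc, hpc⟩ := exists_perp_of_line hL p
  exact ⟨c, ⟨L, hL, ha, hb, hc⟩, hpc⟩

theorem exists_third {a b : Q} (h : 𝔔.Perp a b) (hab : a ≠ b) :
    ∃ c, 𝔔.Col a b c ∧ c ≠ a ∧ c ≠ b := by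
  obtain ⟨L, hL, ha, hb⟩ := h.resolve_left hab
  have h3 := 𝔔.three_le_card L hL
  by_contra! hc
  have : L ⊆ {a, b} := fun c hcL => by
    by_cases hca : c = a
    · exact Or.inl hca
    · exact Or.inr (hc c ⟨L, hL, ha, hb, hcL⟩ hca)
  have h2 := (Set.encard_le_encard this).trans (Set.encard_insert_le {b} a)
  rw [Set.encard_singleton] at h2
  have := h3.trans h2
  norm_num at this

variable (𝔔) in
/-- The points collinear with all points of `X`. -/
def orth (X : Set Q) : Set Q := {a | ∀ x ∈ X, 𝔔.Perp x a}

theorem isSubspace_orth (X : Set Q) : 𝔔.IsSubspace (𝔔.orth X) :=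
  fun _ hL _ _ hab ha hb haX hbX _ hc x hx => perp_of_line hL ha hb hc hab (haX x hx) (hbX x hx)

theorem IsSubspace.inter {X Y : Set Q} (hX : 𝔔.IsSubspace X) (hY : 𝔔.IsSubspace Y) :
    𝔔.IsSubspace (X ∩ Y) := fun L hL a b hab ha hb haX hbX =>
  Set.subset_inter (hX L hL a b hab ha hb haX.1 hbX.1) (hY L hL a b hab ha hb haX.2 hbX.2)

theorem IsStrong.inter {X Y : Set Q} (hX : 𝔔.IsStrong X) (hY : 𝔔.IsSubspace Y) :
    𝔔.IsStrong (X ∩ Y) := ⟨hX.1.inter hY, fun a ha b hb => hX.2 a ha.1 b hb.1⟩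

variable (𝔔) in
/-- A subspace in which no point is collinear with all points. -/
def IsNondegenerate (W : Set Q) : Prop :=
  𝔔.IsSubspace W ∧ ∀ y ∈ W, ∃ p ∈ W, ¬ 𝔔.Perp p y

theorem isNondegenerate_univ : 𝔔.IsNondegenerate Set.univ := by
  refine ⟨fun _ _ _ _ _ _ _ _ _ => Set.subset_univ _, fun y _ => ?_⟩
  obtain ⟨b, hb, h⟩ := 𝔔.nondegenerate y
  refine ⟨b, trivial, ?_⟩
  intro hp
  rcases hp.symm with rfl | h'
  · exact hb rfl
  · exact h h'

/-- Suppose that in `W` everything collinear with `x` is collinear with `y`, where `x ⊥ y`. For `q`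
not collinear with `y`, some `r` on the line `xy` has `q ⊥ r`. Given `s` not collinear with `r`,
project `s` to `t` on `qr`, then `x` to `n` on `st`. By assumption `n ⊥ y`, so `n ⊥ r`; as also `t ⊥
r`, the whole line `st` is collinear with `r`, against the choice of `s`. -/
theorem IsNondegenerate.separate {W : Set Q} (hW : 𝔔.IsNondegenerate W) {x y : Q} (hx : x ∈ W)
    (hy : y ∈ W) (hxy : x ≠ y) : ∃ p ∈ W, 𝔔.Perp p x ∧ ¬ 𝔔.Perp p y := by
  by_cases hp : 𝔔.Perp x y
  swap
  · exact ⟨x, hx, Perp.refl x, hp⟩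
  by_contra! hcon
  obtain ⟨q, hq, hqy⟩ := hW.2 y hy
  have hqx : ¬ 𝔔.Perp q x := fun h => hqy (hcon q hq h)
  obtain ⟨r, hr, hqr⟩ := exists_col_perp hp hxy q
  have hrW := hW.1.col hx hy hxy hr
  obtain ⟨s, hs, hsr⟩ := hW.2 r hrW
  have hrq : q ≠ r := by rintro rfl; exact hqx hr.perp.symm
  obtain ⟨t, ht, hst⟩ := exists_col_perp hqr hrq s
  have htW := hW.1.col hq hrW hrq ht
  have htr : t ≠ r := by rintro rfl; exact hsr hst
  have htx : ¬ 𝔔.Perp t x := fun h =>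
    hqx (perp_of_col ht.rot htr.symm hr.perp h.symm).symm
  have hst' : s ≠ t := by
    rintro rfl; exact hsr ht.swap.perp.symm
  obtain ⟨n, hn, hxn⟩ := exists_col_perp hst hst' x
  have hnW := hW.1.col hs htW hst' hn
  have hny := hcon n hnW hxn.symm
  have hnr := perp_of_col hr hxy hxn.symm hny
  have hnt : t ≠ n := by rintro rfl; exact htx hxn.symm
  exact hsr (perp_of_col hn.rot hnt ht.swap.perp hnr.symm).symm

/-- The orthogonal complement of a hyperbolic pair stays nondegenerate: a point separating `y` from
`x` can be moved along its line through `y` into the complement of `q` and still separates, since `x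
⊥ y`. -/
theorem IsNondegenerate.hyperbolic {W : Set Q} (hW : 𝔔.IsNondegenerate W) {y q : Q} (hy : y ∈ W)
    (hq : q ∈ W) (hqy : ¬ 𝔔.Perp q y) : 𝔔.IsNondegenerate (W ∩ (𝔔.orth {y} ∩ 𝔔.orth {q})) := by
  refine ⟨hW.1.inter ((isSubspace_orth _).inter (isSubspace_orth _)), ?_⟩
  rintro x ⟨hx, hyx, hqx⟩
  have hyx := hyx y rfl
  have hqx := hqx q rfl
  have hne : y ≠ x := by rintro rfl; exact hqy hqx
  obtain ⟨p, hp, hpy, hpx⟩ := hW.separate hy hx hne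
  have hpy' : p ≠ y := by rintro rfl; exact hpx hyx
  obtain ⟨p', hp', hqp⟩ := exists_col_perp hpy hpy' q
  have hne' : y ≠ p' := by rintro rfl; exact hqy hqp
  refine ⟨p', ⟨hW.1.col hp hy hpy' hp', ?_, ?_⟩, ?_⟩
  · rintro _ rfl; exact hp'.swap.perp
  · rintro _ rfl; exact hqp
  · intro h
    exact hpx (perp_of_col hp'.rot hne' hyx.symm h.symm).symm

variable (𝔔) in
/-- The strong subspace `X` has (vector space) rank `n`. -/
def Rk (X : Set Q) (n : ℕ) : Prop :=
  ∃ h : 𝔔.IsStrong X, Order.height (⟨X, h⟩ : 𝔔.Strong) = n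

variable (𝔔) in
/-- All strong subspaces have finite rank. -/
def FiniteRank : Prop := ∀ X, 𝔔.IsStrong X → ∃ n, 𝔔.Rk X n

theorem HasIndex.finiteRank {m : ℕ} (h : 𝔔.HasIndex m) : 𝔔.FiniteRank := by
  intro X hX
  have h1 := h.2 ⟨X, hX⟩
  have : Order.height (⟨X, hX⟩ : 𝔔.Strong) ≠ ⊤ := ne_top_of_le_ne_top (by simp) h1
  obtain ⟨n, hn⟩ := ENat.ne_top_iff_exists.1 this
  exact ⟨n, hX, hn.symm⟩

theorem Rk.unique {X : Set Q} {n n' : ℕ} (h : 𝔔.Rk X n) (h' : 𝔔.Rk X n') : n = n' := by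
  obtain ⟨h1, h2⟩ := h
  obtain ⟨_, h4⟩ := h'
  exact_mod_cast h2.symm.trans h4

theorem Rk.lt {X Y : Set Q} {n n' : ℕ} (h : 𝔔.Rk X n) (h' : 𝔔.Rk Y n') (hXY : X ⊂ Y) :
    n < n' := by
  obtain ⟨h1, h2⟩ := h
  obtain ⟨h3, h4⟩ := h'
  have : (⟨X, h1⟩ : 𝔔.Strong) < ⟨Y, h3⟩ := hXY
  have := Order.height_strictMono this (by rw [h2]; simp)
  rw [h2, h4] at this
  exact_mod_cast this

theorem Rk.le {X Y : Set Q} {n n' : ℕ} (h : 𝔔.Rk X n) (h' : 𝔔.Rk Y n') (hXY : X ⊆ Y) :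
    n ≤ n' := by
  rcases hXY.eq_or_ssubset with rfl | h1
  · exact (h.unique h').le
  · exact (h.lt h' h1).le

theorem Rk.eq_of_subset {X Y : Set Q} {n : ℕ} (h : 𝔔.Rk X n) (h' : 𝔔.Rk Y n) (hXY : X ⊆ Y) :
    X = Y := by
  rcases hXY.eq_or_ssubset with h1 | h1
  · exact h1
  · exact absurd (h.lt h' h1) (lt_irrefl _)

theorem Rk.isStrong {X : Set Q} {n : ℕ} (h : 𝔔.Rk X n) : 𝔔.IsStrong X := h.1

/-- A point of `W` collinear with the strong subspace `X` of `W` but outside `X` is separated from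
`X` by a point of `W`. -/
theorem IsNondegenerate.separate_strong (hf : 𝔔.FiniteRank) {X : Set Q} (hX : 𝔔.IsStrong X) :
    ∀ {W : Set Q}, 𝔔.IsNondegenerate W → X ⊆ W → ∀ {a : Q}, a ∈ W → a ∈ 𝔔.orth X → a ∉ X →
      ∃ p ∈ W, p ∈ 𝔔.orth X ∧ ¬ 𝔔.Perp p a := by
  obtain ⟨n, hn⟩ := hf X hX
  induction n using Nat.strong_induction_on generalizing X with
  | _ n ih =>
  intro W hW hXW a ha haX haX'
  rcases X.eq_empty_or_nonempty with rfl | ⟨y, hy⟩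
  · obtain ⟨p, hp, h⟩ := hW.2 a ha
    exact ⟨p, hp, by simp [orth], h⟩
  obtain ⟨q, hq, hqy⟩ := hW.2 y (hXW hy)
  -- Induction on the rank: in the complement of the hyperbolic pair `y`, `q`, the subspace `X`
  -- shrinks to its points collinear with `q`, and `a` is replaced by the point `a'` of the line
  -- `ya` collinear with `q`. A separating point found there is collinear with `y`, hence with all
  -- of `X`.
  have hX' := hX.inter (isSubspace_orth {q})
  obtain ⟨n', hn'⟩ := hf _ hX'
  have hlt : n' < n := by
    refine hn'.lt hn ⟨Set.inter_subset_left, fun h => ?_⟩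
    exact hqy ((h hy).2 q rfl)
  have hya : y ≠ a := by rintro rfl; exact haX' hy
  have hyap := haX y hy
  obtain ⟨a', ha', hqa'⟩ := exists_col_perp hyap hya q
  have hya' : y ≠ a' := by rintro rfl; exact hqy hqa'
  have haX1 : a' ∈ 𝔔.orth X := (isSubspace_orth X).col (fun x hx => hX.2 x hx y hy) haX hya ha'
  obtain ⟨p, hp, hpX, hpa⟩ := ih n' hlt hX' hn' (hW.hyperbolic (hXW hy) hq hqy)
    (fun x hx => ⟨hXW hx.1, by rintro _ rfl; exact hX.2 _ hy _ hx.1, hx.2⟩)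
    (a := a') ⟨hW.1.col (hXW hy) ha hya ha', by rintro _ rfl; exact ha'.perp,
      by rintro _ rfl; exact hqa'⟩ (fun x hx => haX1 x hx.1)
    (fun h => haX' (hX.1.col hy h.1 hya' ha'.swap'))
  have hpy : 𝔔.Perp p y := (hp.2.1 y rfl).symm
  refine ⟨p, hp.1, fun x hx => ?_, fun h => hpa (perp_of_col ha' hya hpy h)⟩
  by_cases hxy : x = y
  · subst hxy; exact hpy.symm
  obtain ⟨x', hx', hqx'⟩ := exists_col_perp (hX.2 x hx y hy) hxy q
  have hne : y ≠ x' := by rintro rfl; exact hqy hqx'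
  have hpx' := hpX x' ⟨hX.1.col hx hy hxy hx', by rintro _ rfl; exact hqx'⟩
  exact (perp_of_col hx'.rot hne hpy hpx'.symm).symm

theorem exists_separating (hf : 𝔔.FiniteRank) {X : Set Q} (hX : 𝔔.IsStrong X) {a : Q}
    (ha : a ∈ 𝔔.orth X) (haX : a ∉ X) : ∃ p ∈ 𝔔.orth X, ¬ 𝔔.Perp p a :=
  let ⟨p, _, h1, h2⟩ := isNondegenerate_univ.separate_strong hf hX (Set.subset_univ _)
    (Set.mem_univ a) ha haX
  ⟨p, h1, h2⟩

variable (𝔔) in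
/-- The subspace generated by `X` and `a`. -/
def join (X : Set Q) (a : Q) : Set Q := ⋂₀ {Y | 𝔔.IsSubspace Y ∧ X ⊆ Y ∧ a ∈ Y}

theorem subset_join (X : Set Q) (a : Q) : X ⊆ 𝔔.join X a := Set.subset_sInter fun _ h => h.2.1

theorem mem_join (X : Set Q) (a : Q) : a ∈ 𝔔.join X a := Set.mem_sInter.2 fun _ h => h.2.2

theorem join_subset {X Y : Set Q} {a : Q} (hY : 𝔔.IsSubspace Y) (hX : X ⊆ Y) (ha : a ∈ Y) :
    𝔔.join X a ⊆ Y := Set.sInter_subset_of_mem ⟨hY, hX, ha⟩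

theorem isSubspace_join (X : Set Q) (a : Q) : 𝔔.IsSubspace (𝔔.join X a) :=
  fun L hL x y hxy hx hy hxX hyX => Set.subset_sInter fun Y hY =>
    hY.1 L hL x y hxy hx hy (hxX Y hY) (hyX Y hY)

theorem IsStrong.join {X : Set Q} (hX : 𝔔.IsStrong X) {a : Q} (ha : a ∈ 𝔔.orth X) :
    𝔔.IsStrong (𝔔.join X a) := by
  refine ⟨isSubspace_join X a, ?_⟩
  have h1 : 𝔔.join X a ⊆ 𝔔.orth X := join_subset (isSubspace_orth X)
    (fun x hx y hy => hX.2 y hy x hx) ha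
  have h2 : 𝔔.join X a ⊆ 𝔔.orth {a} := join_subset (isSubspace_orth _)
    (by rintro x hx _ rfl; exact (ha x hx).symm) (by rintro _ rfl; exact Perp.refl _)
  have h3 : 𝔔.join X a ⊆ 𝔔.orth (𝔔.join X a) := join_subset (isSubspace_orth _)
    (fun x hx y hy => (h1 hy x hx).symm) (fun y hy => (h2 hy a rfl).symm)
  exact fun x hx y hy => h3 hy x hx

/-- The join is a cone with vertex `a`. With `p` separating `a` from `X`, the candidate `f` is the
point of the line `aw` collinear with `p`. Were `f` outside `X`, a point `p'` would separate it from
`X`. Inside the complement of `X`, take `g` on `pf` collinear with `p'`, then `z` on `p'g` collinear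
with `a`. Now `z` is collinear with the whole join, so with `f`; together with `g ⊥ f` this forces
`p' ⊥ f`. -/
theorem exists_col_of_mem_join (hf : 𝔔.FiniteRank) {X : Set Q} (hX : 𝔔.IsStrong X) {a w : Q}
    (ha : a ∈ 𝔔.orth X) (haX : a ∉ X) (hw : w ∈ 𝔔.join X a) (hwa : w ≠ a) :
    ∃ f ∈ X, 𝔔.Col a w f := by
  have hY := hX.join ha
  obtain ⟨p, hpX, hpa⟩ := exists_separating hf hX ha haX
  obtain ⟨f, hf1, hpf⟩ := exists_col_perp (hY.2 a (mem_join X a) w hw) hwa.symm p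
  have hfY := hY.1.col (mem_join X a) hw hwa.symm hf1
  refine ⟨f, ?_, hf1⟩
  by_contra hfX
  have hfo : f ∈ 𝔔.orth X := fun x hx => hY.2 x (subset_join X a hx) f hfY
  obtain ⟨p', hp'X, hp'f⟩ := exists_separating hf hX hfo hfX
  have hfa : 𝔔.Perp f a := hY.2 f hfY a (mem_join X a)
  have hpf' : p ≠ f := by rintro rfl; exact hpa hfa
  obtain ⟨g, hg, hp'g⟩ := exists_col_perp hpf hpf' p'
  have hgf : f ≠ g := by rintro rfl; exact hp'f hp'g
  have hgo := (isSubspace_orth X).col hpX hfo hpf' hg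
  have hga : ¬ 𝔔.Perp g a := fun h => hpa (perp_of_col hg.rot hgf hfa.symm h.symm).symm
  have hgp : g ≠ p' := by rintro rfl; exact hp'f (hg.swap.perp.symm)
  obtain ⟨z, hz, haz⟩ := exists_col_perp hp'g.symm hgp a
  have hzX := (isSubspace_orth X).col hgo hp'X hgp hz
  have hzf : 𝔔.Perp z f := by
    have : 𝔔.join X a ⊆ 𝔔.orth {z} := join_subset (isSubspace_orth _)
      (by rintro x hx _ rfl; exact (hzX x hx).symm) (by rintro _ rfl; exact haz.symm)
    exact this hfY z rfl
  have hzg : z ≠ g := by rintro rfl; exact hga haz.symm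
  exact hp'f (perp_of_col hz.rot.rot hzg hzf.symm hg.swap.perp).symm

theorem join_inter_orth (hf : 𝔔.FiniteRank) {X : Set Q} (hX : 𝔔.IsStrong X) {a p : Q}
    (ha : a ∈ 𝔔.orth X) (hpX : p ∈ 𝔔.orth X) (hpa : ¬ 𝔔.Perp p a) :
    𝔔.join X a ∩ 𝔔.orth {p} = X := by
  have haX : a ∉ X := fun h => hpa (hpX a h).symm
  refine Set.Subset.antisymm ?_ fun x hx =>
    ⟨subset_join X a hx, by rintro _ rfl; exact (hpX x hx).symm⟩
  rintro w ⟨hw, hpw⟩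
  have hpw := hpw p rfl
  have hwa : w ≠ a := by rintro rfl; exact hpa hpw
  obtain ⟨f, hfX, h⟩ := exists_col_of_mem_join hf hX ha haX hw hwa
  by_cases hwf : w = f
  · exact hwf ▸ hfX
  · exact absurd (perp_of_col h.rot hwf hpw (hpX f hfX).symm) hpa

variable (𝔔) in
/-- `T` is a subspace that meets every line inside `Z`. -/
def MeetsLines (T Z : Set Q) : Prop :=
  𝔔.IsSubspace T ∧ ∀ L ∈ 𝔔.lines, L ⊆ Z → (L ∩ T).Nonempty

theorem meetsLines_orth (p : Q) (Z : Set Q) : 𝔔.MeetsLines (𝔔.orth {p}) Z := by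
  refine ⟨isSubspace_orth _, fun L hL _ => ?_⟩
  obtain ⟨c, hc, h⟩ := exists_perp_of_line hL p
  exact ⟨c, hc, by rintro _ rfl; exact h⟩

theorem meetsLines_join (hf : 𝔔.FiniteRank) {X : Set Q} (hX : 𝔔.IsStrong X) {a : Q}
    (ha : a ∈ 𝔔.orth X) : 𝔔.MeetsLines X (𝔔.join X a) := by
  refine ⟨hX.1, fun L hL hLZ => ?_⟩
  by_cases haX : a ∈ X
  · obtain ⟨c, hc, -⟩ := exists_perp_of_line hL a
    exact ⟨c, hc, join_subset hX.1 subset_rfl haX (hLZ hc)⟩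
  obtain ⟨p, hpX, hpa⟩ := exists_separating hf hX ha haX
  obtain ⟨c, hc, h⟩ := exists_perp_of_line hL p
  refine ⟨c, hc, ?_⟩
  rw [← join_inter_orth hf hX ha hpX hpa]
  exact ⟨hLZ hc, by rintro _ rfl; exact h⟩

theorem MeetsLines.mono {T Z Z' : Set Q} (h : 𝔔.MeetsLines T Z) (hZ : Z' ⊆ Z) :
    𝔔.MeetsLines T Z' := ⟨h.1, fun L hL hLZ => h.2 L hL (hLZ.trans hZ)⟩

/-- Every line of `Z` through `z` meets `T`, so `Z` is a cone over `Z ∩ T`. -/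
theorem MeetsLines.join_eq {T Z : Set Q} (h : 𝔔.MeetsLines T Z) (hZ : 𝔔.IsStrong Z) {z : Q}
    (hz : z ∈ Z) (hzT : z ∉ T) : 𝔔.join (Z ∩ T) z = Z := by
  refine Set.Subset.antisymm (join_subset hZ.1 Set.inter_subset_left hz) fun w hw => ?_
  by_cases hwz : w = z
  · subst hwz; exact mem_join _ _
  obtain ⟨L, hL, hzL, hwL⟩ := (hZ.2 z hz w hw).resolve_left (Ne.symm hwz)
  have hLZ := hZ.1 L hL z w (Ne.symm hwz) hzL hwL hz hw
  obtain ⟨t, htL, htT⟩ := h.2 L hL hLZ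
  have hzt : z ≠ t := by rintro rfl; exact hzT htT
  exact (isSubspace_join _ _).col (mem_join _ _) (subset_join (Z ∩ T) z ⟨hLZ htL, htT⟩) hzt
    ⟨L, hL, hzL, htL, hwL⟩

/-- The rank is the length of a longest chain, so the point is the upper bound: every proper strong
subspace `Z` of the join must have rank at most `n`. If `Z` is not inside `X`, it is the join of `Z
∩ X` and one point, and `Z ∩ X` is proper in `X`, so the induction hypothesis applies to it. -/
theorem Rk.join (hf : 𝔔.FiniteRank) {X : Set Q} {n : ℕ} (hX : 𝔔.Rk X n) {a : Q}
    (ha : a ∈ 𝔔.orth X) (haX : a ∉ X) : 𝔔.Rk (𝔔.join X a) (n + 1) := by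
  induction n using Nat.strong_induction_on generalizing X a with
  | _ n ih =>
  have hXs := hX.isStrong
  have hY := hXs.join ha
  obtain ⟨l, hl⟩ := hf _ hY
  have h1 : n < l := hX.lt hl ⟨subset_join X a, fun h => haX (h (mem_join X a))⟩
  suffices l ≤ n + 1 by
    have : l = n + 1 := by omega
    exact this ▸ hl
  have hsup : Order.height (⟨𝔔.join X a, hY⟩ : 𝔔.Strong) ≤ ((n + 1 : ℕ) : ℕ∞) := by
    rw [Order.height_eq_iSup_lt_height]
    refine iSup₂_le fun Z hZ => ?_
    obtain ⟨Z, hZs⟩ := Z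
    obtain ⟨j, hj⟩ := hf Z hZs
    have hZY : Z ⊂ 𝔔.join X a := hZ
    have hle : j ≤ n := by
      by_cases hZX : Z ⊆ X
      · exact hj.le hX hZX
      obtain ⟨z, hz, hzX⟩ := Set.not_subset.1 hZX
      have hML := (meetsLines_join hf hXs ha).mono hZY.subset
      have hZi := hZs.inter hXs.1
      obtain ⟨i, hi⟩ := hf _ hZi
      -- If `Z` contained `X`, the line from `a` to a point of `Z` outside `X` would meet `X`, hence
      -- lie in `Z`, and `Z` would be the whole join.
      have hin : i < n := by
        refine hi.lt hX ⟨Set.inter_subset_right, fun h => hZY.2 ?_⟩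
        have hXZ : X ⊆ Z := fun x hx => (h hx).1
        by_cases hza : z = a
        · exact join_subset hZs.1 hXZ (hza ▸ hz)
        obtain ⟨f, hfX, hc⟩ := exists_col_of_mem_join hf hXs ha haX (hZY.1 hz) hza
        have hzf : z ≠ f := by rintro rfl; exact hzX hfX
        exact join_subset hZs.1 hXZ (hZs.1.col hz (hXZ hfX) hzf hc.rot)
      have h2 := ih i hin hi (a := z) (fun x hx => hZs.2 x hx.1 z hz) (fun h => hzX h.2)
      rw [hML.join_eq hZs hz hzX] at h2
      have := h2.unique hj
      omega
    obtain ⟨_, hj⟩ := hj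
    rw [hj]
    exact_mod_cast Nat.succ_le_succ hle
  obtain ⟨_, hl⟩ := hl
  rw [hl] at hsup
  exact_mod_cast hsup

end PolarSpace

/-! ### Dimension arithmetic, extension of strong subspaces, hyperplane sections -/

namespace PolarSpace

variable {Q : Type*} {𝔔 : PolarSpace Q}

theorem MeetsLines.rk (hf : 𝔔.FiniteRank) {T Z : Set Q} (h : 𝔔.MeetsLines T Z) {j : ℕ}
    (hZ : 𝔔.Rk Z (j + 1)) (hZT : ¬ Z ⊆ T) : 𝔔.Rk (Z ∩ T) j := by
  obtain ⟨z, hz, hzT⟩ := Set.not_subset.1 hZT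
  have hZi := hZ.isStrong.inter h.1
  obtain ⟨i, hi⟩ := hf _ hZi
  have h2 := hi.join hf (a := z) (fun x hx => hZ.isStrong.2 x hx.1 z hz) (fun h => hzT h.2)
  rw [h.join_eq hZ.isStrong hz hzT] at h2
  have := h2.unique hZ
  obtain rfl : i = j := by omega
  exact hi

theorem Rk.join_eq (hf : 𝔔.FiniteRank) {A B : Set Q} {n : ℕ} (hA : 𝔔.Rk A n)
    (hB : 𝔔.Rk B (n + 1)) (hAB : A ⊆ B) {b : Q} (hb : b ∈ B) (hbA : b ∉ A) : 𝔔.join A b = B :=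
  (hA.join hf (fun x hx => hB.isStrong.2 x (hAB hx) b hb) hbA).eq_of_subset hB
    (join_subset hB.isStrong.1 hAB hb)

theorem Rk.not_subset {A B : Set Q} {n l : ℕ} (hA : 𝔔.Rk A n) (hB : 𝔔.Rk B l) (h : n < l) :
    ¬ B ⊆ A := fun h' => absurd (hB.le hA h') (by omega)

theorem Rk.meetsLines (hf : 𝔔.FiniteRank) {A B : Set Q} {n : ℕ} (hA : 𝔔.Rk A n)
    (hB : 𝔔.Rk B (n + 1)) (hAB : A ⊆ B) : 𝔔.MeetsLines A B := by
  obtain ⟨b, hb, hbA⟩ := Set.not_subset.1 (hA.not_subset hB (Nat.lt_succ_self n))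
  rw [← hA.join_eq hf hB hAB hb hbA]
  exact meetsLines_join hf hA.isStrong fun x hx => hB.isStrong.2 x (hAB hx) b hb

theorem Rk.inter (hf : 𝔔.FiniteRank) {A B Z : Set Q} {n j : ℕ} (hA : 𝔔.Rk A n)
    (hB : 𝔔.Rk B (n + 1)) (hAB : A ⊆ B) (hZ : 𝔔.Rk Z (j + 1)) (hZB : Z ⊆ B) (hZA : ¬ Z ⊆ A) :
    𝔔.Rk (Z ∩ A) j :=
  ((hA.meetsLines hf hB hAB).mono hZB).rk hf hZ hZA

theorem Rk.inter_of_ne (hf : 𝔔.FiniteRank) {A A' B : Set Q} {n : ℕ} (hA : 𝔔.Rk A (n + 1))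
    (hA' : 𝔔.Rk A' (n + 1)) (hB : 𝔔.Rk B (n + 2)) (hAB : A ⊆ B) (hAB' : A' ⊆ B) (h : A ≠ A') :
    𝔔.Rk (A ∩ A') n :=
  hA'.inter hf hB hAB' hA hAB fun h' => h (hA.eq_of_subset hA' h')

/-- A subspace containing a maximal proper subspace of `A` and one more point contains `A`. -/
theorem Rk.subset_of_mem (hf : 𝔔.FiniteRank) {C A T : Set Q} {n : ℕ} (hC : 𝔔.Rk C n)
    (hA : 𝔔.Rk A (n + 1)) (hCA : C ⊆ A) (hT : 𝔔.IsSubspace T) (hCT : C ⊆ T) {x : Q} (hx : x ∈ A)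
    (hxC : x ∉ C) (hxT : x ∈ T) : A ⊆ T := by
  rw [← hC.join_eq hf hA hCA hx hxC]
  exact join_subset hT hCT hxT

theorem Rk.subset_of_ne (hf : 𝔔.FiniteRank) {C C' A T : Set Q} {n : ℕ} (hC : 𝔔.Rk C n)
    (hC' : 𝔔.Rk C' n) (hA : 𝔔.Rk A (n + 1)) (hCA : C ⊆ A) (hC'A : C' ⊆ A) (hne : C ≠ C')
    (hT : 𝔔.IsSubspace T) (hCT : C ⊆ T) (hC'T : C' ⊆ T) : A ⊆ T := by
  have : ¬ C' ⊆ C := fun h => hne (hC'.eq_of_subset hC h).symm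
  obtain ⟨x, hx, hxC⟩ := Set.not_subset.1 this
  exact hC.subset_of_mem hf hA hCA hT hCT (hC'A hx) hxC (hC'T hx)

theorem Rk.inter_eq (hf : 𝔔.FiniteRank) {C A A' : Set Q} {n : ℕ} (hC : 𝔔.Rk C n)
    (hA : 𝔔.Rk A (n + 1)) (hA' : 𝔔.Rk A' (n + 1)) (hCA : C ⊆ A) (hCA' : C ⊆ A') (h : A ≠ A') :
    A ∩ A' = C := by
  refine Set.Subset.antisymm (fun x hx => ?_) (Set.subset_inter hCA hCA')
  by_contra hxC
  exact h (hA.eq_of_subset hA' (hC.subset_of_mem hf hA hCA hA'.isStrong.1 hCA' hx.1 hxC hx.2))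

theorem isStrong_empty : 𝔔.IsStrong ∅ :=
  ⟨fun _ _ _ _ _ _ _ h => absurd h (Set.notMem_empty _), fun _ h => absurd h (Set.notMem_empty _)⟩

theorem rk_empty : 𝔔.Rk ∅ 0 := by
  refine ⟨isStrong_empty, ?_⟩
  rw [Nat.cast_zero, Order.height_eq_zero]
  intro b _
  exact Set.empty_subset _

theorem Rk.eq_empty {X : Set Q} (h : 𝔔.Rk X 0) : X = ∅ :=
  (rk_empty.eq_of_subset h (Set.empty_subset _)).symm

theorem isStrong_singleton (a : Q) : 𝔔.IsStrong {a} := by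
  refine ⟨?_, ?_⟩
  · rintro L hL x y hxy _ _ rfl rfl; exact absurd rfl hxy
  · rintro x rfl y rfl; exact Perp.refl _

theorem rk_singleton (hf : 𝔔.FiniteRank) (a : Q) : 𝔔.Rk {a} 1 := by
  have h := (rk_empty (𝔔 := 𝔔)).join hf (a := a) (by simp [orth]) (Set.notMem_empty a)
  have : 𝔔.join ∅ a = {a} := Set.Subset.antisymm
    (join_subset (isStrong_singleton a).1 (Set.empty_subset _) rfl)
    (by rintro _ rfl; exact mem_join _ _)
  rwa [this] at h

theorem Rk.eq_singleton (hf : 𝔔.FiniteRank) {X : Set Q} (h : 𝔔.Rk X 1) {a : Q} (ha : a ∈ X) :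
    X = {a} :=
  ((rk_singleton hf a).eq_of_subset h (by simpa using ha)).symm

theorem exists_between (hf : 𝔔.FiniteRank) {Y A : Set Q} {j i l : ℕ} (hY : 𝔔.Rk Y j)
    (hA : 𝔔.Rk A l) (hYA : Y ⊆ A) (hji : j ≤ i) (hil : i ≤ l) :
    ∃ Z, 𝔔.Rk Z i ∧ Y ⊆ Z ∧ Z ⊆ A := by
  induction i, hji using Nat.le_induction with
  | base => exact ⟨Y, hY, subset_rfl, hYA⟩
  | succ i _ ih =>
    obtain ⟨Z, hZ, hYZ, hZA⟩ := ih (by omega)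
    obtain ⟨x, hx, hxZ⟩ := Set.not_subset.1 (hZ.not_subset hA (by omega))
    exact ⟨𝔔.join Z x, hZ.join hf (fun z hz => hA.isStrong.2 z (hZA hz) x hx) hxZ,
      hYZ.trans (subset_join _ _), join_subset hA.isStrong.1 hZA hx⟩

/-- A pencil contains at least two elements other than a given one. -/
theorem exists_pencil_ne (hf : 𝔔.FiniteRank) {C A B : Set Q} {n : ℕ} (hC : 𝔔.Rk C n)
    (hA : 𝔔.Rk A (n + 1)) (hB : 𝔔.Rk B (n + 2)) (hCA : C ⊆ A) (hAB : A ⊆ B) :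
    ∃ X X', 𝔔.Rk X (n + 1) ∧ 𝔔.Rk X' (n + 1) ∧ C ⊆ X ∧ C ⊆ X' ∧ X ⊆ B ∧ X' ⊆ B ∧ X ≠ X' ∧
      X ≠ A ∧ X' ≠ A := by
  obtain ⟨a, ha, haC⟩ := Set.not_subset.1 (hC.not_subset hA (by omega))
  -- The two new members are `C + b` and `C + c`, with `c` a third point of the line `ab`; if they
  -- coincided they would contain `a`, although they meet `A` only in `C`.
  obtain ⟨b, hb, hbA⟩ := Set.not_subset.1 (hA.not_subset hB (by omega))
  have hab : a ≠ b := by rintro rfl; exact hbA ha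
  have hBs := hB.isStrong
  obtain ⟨c, hc, hca, hcb⟩ := exists_third (hBs.2 a (hAB ha) b hb) hab
  have hcB := hBs.1.col (hAB ha) hb hab hc
  have hcA : c ∉ A := fun h => hbA (hA.isStrong.1.col ha h hca.symm hc.swap')
  have key : ∀ z ∈ B, z ∉ A → 𝔔.Rk (𝔔.join C z) (n + 1) ∧ C ⊆ 𝔔.join C z ∧ 𝔔.join C z ⊆ B ∧
      𝔔.join C z ≠ A := fun z hz hzA =>
    ⟨hC.join hf (fun x hx => hBs.2 x (hAB (hCA hx)) z hz) (fun h => hzA (hCA h)),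
      subset_join _ _, join_subset hBs.1 (hCA.trans hAB) hz, fun h => hzA (h ▸ mem_join C z)⟩
  obtain ⟨h1, h2, h3, h4⟩ := key b hb hbA
  obtain ⟨h5, h6, h7, h8⟩ := key c hcB hcA
  refine ⟨_, _, h1, h5, h2, h6, h3, h7, fun h => ?_, h4, h8⟩
  have hcX : c ∈ 𝔔.join C b := h ▸ mem_join C c
  have haX := h1.isStrong.1.col hcX (mem_join C b) hcb hc.rot.swap
  have := hC.inter_eq hf h1 hA h2 hCA h4
  exact haC (this ▸ ⟨haX, ha⟩)

/-- Build `Y` up one rank at a time. If the new point can be chosen in `M`, it is collinear with all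
of `M`, so `N` is kept and the rank of `Y ∩ M` grows by at most one. Otherwise `Y ∩ M` is unchanged,
and imposing collinearity with the new point lowers the rank of `N` by at most one. -/
theorem exists_orth_of_rk (hf : 𝔔.FiniteRank) {M : Set Q} {l : ℕ} (hM : 𝔔.Rk M l) (n : ℕ) :
    ∀ {Y : Set Q}, 𝔔.Rk Y n → ∃ N r s, N ⊆ M ∧ N ⊆ 𝔔.orth Y ∧ 𝔔.Rk (Y ∩ M) r ∧ 𝔔.Rk N s ∧
      l + r ≤ s + n := by
  induction n with
  | zero =>
    intro Y hY
    obtain rfl := hY.eq_empty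
    exact ⟨M, 0, l, subset_rfl, by simp [orth], by simpa using rk_empty, hM, by omega⟩
  | succ n ih =>
    intro Y' hY'
    obtain ⟨Y, hY, -, hYY'⟩ := exists_between hf rk_empty hY' (Set.empty_subset _) (Nat.zero_le n)
      (Nat.le_succ n)
    obtain ⟨N, r, s, hNM, hNY, hr, hs, hle⟩ := ih hY
    have extend : ∀ y ∈ Y', y ∉ Y → ∀ a ∈ N, 𝔔.Perp y a → a ∈ 𝔔.orth Y' := by
      intro y hy hyY a ha hya x hx
      have : Y' ⊆ 𝔔.orth {a} := hY.subset_of_mem hf hY' hYY' (isSubspace_orth _)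
        (by rintro x hx _ rfl; exact (hNY ha x hx).symm) hy hyY (by rintro _ rfl; exact hya.symm)
      exact (this hx a rfl).symm
    by_cases hc : Y' ∩ M ⊆ Y
    · have heq : Y' ∩ M = Y ∩ M := Set.Subset.antisymm
        (Set.subset_inter hc Set.inter_subset_right) (Set.inter_subset_inter_left _ hYY')
      obtain ⟨y, hy, hyY⟩ := Set.not_subset.1 (hY.not_subset hY' (Nat.lt_succ_self n))
      by_cases hN : N ⊆ 𝔔.orth {y}
      · exact ⟨N, r, s, hNM, fun a ha => extend y hy hyY a ha (hN ha y rfl), heq ▸ hr, hs,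
          by omega⟩
      · cases s with
        | zero => obtain rfl := hs.eq_empty; exact absurd (Set.empty_subset _) hN
        | succ s =>
          exact ⟨N ∩ 𝔔.orth {y}, r, s, Set.inter_subset_left.trans hNM,
            fun a ha => extend y hy hyY a ha.1 (ha.2 y rfl), heq ▸ hr,
            (meetsLines_orth y N).rk hf hs hN, by omega⟩
    · obtain ⟨y, ⟨hy, hyM⟩, hyY⟩ := Set.not_subset.1 hc
      obtain ⟨r', hr'⟩ := hf _ (hY'.isStrong.inter hM.isStrong.1)
      refine ⟨N, r', s, hNM, fun a ha => extend y hy hyY a ha (hM.isStrong.2 y hyM a (hNM ha)),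
        hr', hs, ?_⟩
      cases r' with
      | zero => omega
      | succ r' =>
        have h1 := hY.inter hf hY' hYY' hr' Set.inter_subset_left hc
        have : Y' ∩ M ∩ Y = Y ∩ M := by
          ext x; constructor
          · rintro ⟨⟨_, h⟩, h'⟩; exact ⟨h', h⟩
          · rintro ⟨h, h'⟩; exact ⟨⟨hYY' h, h'⟩, h⟩
        rw [this] at h1
        have := h1.unique hr
        omega

theorem mem_sub_iff {X : Set Q} {d : ℤ} {n : ℕ} (h : (n : ℤ) = d + 1) :
    X ∈ 𝔔.sub d ↔ 𝔔.Rk X n := by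
  constructor
  · rintro ⟨h1, n', h2, h3⟩
    obtain rfl : n' = n := by omega
    exact ⟨h1, h2⟩
  · rintro ⟨h1, h2⟩
    exact ⟨h1, n, h2, h⟩

/-- Apply the count to `M` of the top rank `m + 1`: if `X` contained everything collinear with it,
then `N ⊆ X ∩ M`, and the inequality would give `m + 1 ≤ n`. -/
theorem Rk.exists_mem_orth {m : ℕ} (hm : 𝔔.HasIndex m) {X : Set Q} {n : ℕ} (hX : 𝔔.Rk X n)
    (hn : n ≤ m) : ∃ a ∈ 𝔔.orth X, a ∉ X := by
  have hf := hm.finiteRank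
  obtain ⟨M, hM⟩ := hm.1
  rw [mem_sub_iff (n := m + 1) (by push_cast; rfl)] at hM
  obtain ⟨N, r, s, hNM, hNX, hr, hs, hle⟩ := exists_orth_of_rk hf hM n hX
  by_contra! h
  have := hs.le hr (Set.subset_inter (fun a ha => h a (hNX ha)) hNM)
  omega

theorem Rk.exists_succ {m : ℕ} (hm : 𝔔.HasIndex m) {X : Set Q} {n : ℕ} (hX : 𝔔.Rk X n)
    (hn : n ≤ m) : ∃ B, 𝔔.Rk B (n + 1) ∧ X ⊆ B :=
  let ⟨a, ha, haX⟩ := hX.exists_mem_orth hm hn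
  ⟨𝔔.join X a, hX.join hm.finiteRank ha haX, subset_join X a⟩

variable (𝔔) in
/-- Every point of `X` is collinear with every point of `Y`. -/
def PerpSets (X Y : Set Q) : Prop := ∀ x ∈ X, ∀ y ∈ Y, 𝔔.Perp x y

theorem PerpSets.symm {X Y : Set Q} (h : 𝔔.PerpSets X Y) : 𝔔.PerpSets Y X :=
  fun y hy x hx => (h x hx y hy).symm

theorem perpSets_of_subset {X Y B : Set Q} (hB : 𝔔.IsStrong B) (hX : X ⊆ B) (hY : Y ⊆ B) :
    𝔔.PerpSets X Y := fun x hx y hy => hB.2 x (hX hx) y (hY hy)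

theorem PerpSets.mono {X Y X' Y' : Set Q} (h : 𝔔.PerpSets X Y) (hX : X' ⊆ X) (hY : Y' ⊆ Y) :
    𝔔.PerpSets X' Y' := fun x hx y hy => h x (hX hx) y (hY hy)

/-- To be collinear with `A` it suffices to be so with two of its maximal proper subspaces. -/
theorem Rk.perpSets_of_ne (hf : 𝔔.FiniteRank) {C C' A Z : Set Q} {n : ℕ} (hC : 𝔔.Rk C n)
    (hC' : 𝔔.Rk C' n) (hA : 𝔔.Rk A (n + 1)) (hCA : C ⊆ A) (hC'A : C' ⊆ A) (hne : C ≠ C')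
    (h : 𝔔.PerpSets C Z) (h' : 𝔔.PerpSets C' Z) : 𝔔.PerpSets A Z := by
  have : A ⊆ 𝔔.orth Z := hC.subset_of_ne hf hC' hA hCA hC'A hne (isSubspace_orth Z)
    (fun c hc z hz => (h c hc z hz).symm) (fun c hc z hz => (h' c hc z hz).symm)
  exact fun a ha z hz => (this ha z hz).symm

theorem Rk.perpSets_of_mem (hf : 𝔔.FiniteRank) {C A Z : Set Q} {n : ℕ} (hC : 𝔔.Rk C n)
    (hA : 𝔔.Rk A (n + 1)) (hCA : C ⊆ A) {x : Q} (hx : x ∈ A) (hxC : x ∉ C)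
    (h : 𝔔.PerpSets C Z) (h' : x ∈ 𝔔.orth Z) : 𝔔.PerpSets A Z := by
  have : A ⊆ 𝔔.orth Z := hC.subset_of_mem hf hA hCA (isSubspace_orth Z)
    (fun c hc z hz => (h c hc z hz).symm) hx hxC h'
  exact fun a ha z hz => (this ha z hz).symm

/-- Two collinear strong subspaces sharing a subspace of corank one span a strong subspace. -/
theorem Rk.exists_span (hf : 𝔔.FiniteRank) {C A A' : Set Q} {n : ℕ} (hC : 𝔔.Rk C n)
    (hA : 𝔔.Rk A (n + 1)) (hA' : 𝔔.Rk A' (n + 1)) (hCA : C ⊆ A) (hCA' : C ⊆ A') (hne : A ≠ A')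
    (h : 𝔔.PerpSets A A') : ∃ B, 𝔔.Rk B (n + 2) ∧ A ⊆ B ∧ A' ⊆ B := by
  have : ¬ A' ⊆ A := fun h => hne (hA'.eq_of_subset hA h).symm
  obtain ⟨x, hx, hxA⟩ := Set.not_subset.1 this
  have hJ := hA.join hf (a := x) (fun y hy => h y hy x hx) hxA
  exact ⟨_, hJ, subset_join _ _, hC.subset_of_mem hf hA' hCA' hJ.isStrong.1
    (hCA.trans (subset_join _ _)) hx (fun h => hxA (hCA h)) (mem_join _ _)⟩

theorem IsHyperplane.meetsLines {H : Set Q} (hH : 𝔔.IsHyperplane H) (Z : Set Q) :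
    𝔔.MeetsLines H Z := ⟨hH.1, fun L hL _ => hH.2.2 L hL⟩

theorem IsHyperplane.rk_inter (hf : 𝔔.FiniteRank) {H : Set Q} (hH : 𝔔.IsHyperplane H) {X : Set Q}
    {n : ℕ} (hX : 𝔔.Rk X (n + 1)) (hXH : ¬ X ⊆ H) : 𝔔.Rk (X ∩ H) n :=
  (hH.meetsLines X).rk hf hX hXH

theorem IsHyperplane.inter_eq (hf : 𝔔.FiniteRank) {H : Set Q} (hH : 𝔔.IsHyperplane H) {X C : Set Q}
    {n : ℕ} (hX : 𝔔.Rk X (n + 1)) (hXH : ¬ X ⊆ H) (hC : 𝔔.Rk C n) (hCX : C ⊆ X) (hCH : C ⊆ H) :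
    X ∩ H = C :=
  (hC.eq_of_subset (hH.rk_inter hf hX hXH) (Set.subset_inter hCX hCH)).symm

/-- A strong subspace is not the union of two proper subspaces. -/
theorem exists_notMem_union {B T T' : Set Q} (hB : 𝔔.IsStrong B) (hT : 𝔔.IsSubspace T)
    (hT' : 𝔔.IsSubspace T') (h : ¬ B ⊆ T) (h' : ¬ B ⊆ T') : ∃ y ∈ B, y ∉ T ∧ y ∉ T' := by
  obtain ⟨b, hb, hbT⟩ := Set.not_subset.1 h
  obtain ⟨a, ha, haT'⟩ := Set.not_subset.1 h'
  by_cases hbT' : b ∈ T'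
  swap
  · exact ⟨b, hb, hbT, hbT'⟩
  by_cases haT : a ∈ T
  swap
  · exact ⟨a, ha, haT, haT'⟩
  have hab : a ≠ b := by rintro rfl; exact hbT haT
  obtain ⟨c, hc, hca, hcb⟩ := exists_third (hB.2 a ha b hb) hab
  exact ⟨c, hB.1.col ha hb hab hc, fun h => hbT (hT.col haT h hca.symm hc.swap'),
    fun h => haT' (hT'.col hbT' h hcb.symm hc.rot)⟩

theorem subset_of_diff_subset {H X Y : Set Q} (hH : 𝔔.IsSubspace H) (hX : 𝔔.IsStrong X)
    (hXH : ¬ X ⊆ H) (hY : 𝔔.IsSubspace Y) (h : X \ H ⊆ Y) : X ⊆ Y := by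
  by_contra hXY
  obtain ⟨y, hy, hyY, hyH⟩ := exists_notMem_union hX hY hH hXY hXH
  exact hyY (h ⟨hy, hyH⟩)

end PolarSpace

/-! ### Formulas in a ternary collinearity relation -/

section Relations

variable {S : Type*} (R : S → S → S → Prop)

/-- Two distinct elements on a common line. -/
def Adj (x y : S) : Prop := x ≠ y ∧ R x y y

/-- `u` is adjacent to both `x` and `y`. -/
def CommonNbr (x y u : S) : Prop := Adj R u x ∧ Adj R u y

/-- `y` is off some line through `x`, and adjacent to two points of it but not to `x`. -/
def Par (x y : S) : Prop :=
  x ≠ y ∧ ¬ Adj R x y ∧ ∃ u v, u ≠ v ∧ CommonNbr R x y u ∧ CommonNbr R x y v ∧ R x u v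

/-- The elements `x`, `y` share a maximal proper affine subspace but lie in no common strong
subspace. -/
def Share (x y : S) : Prop :=
  x ≠ y ∧ ¬ Adj R x y ∧ (∃ u v, u ≠ v ∧ CommonNbr R x y u ∧ CommonNbr R x y v) ∧
    ¬ ∃ u v z, u ≠ v ∧ CommonNbr R x y u ∧ CommonNbr R x y v ∧ Par R z y ∧ Adj R z u ∧ Adj R z v

/-- The element `a` contains the common subspace of `x` and `y`. -/
def Contains (x y a : S) : Prop :=
  ∃ u v, CommonNbr R x y u ∧ R x u v ∧ (v = a ∨ (Share R a x ∧ CommonNbr R a x v))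

/-- The subspaces coded by three pairs belong to a pencil. -/
def StepCol (x₁ y₁ x₂ y₂ x₃ y₃ : S) : Prop :=
  ∃ a u₁ u₂ u₃, R u₁ u₂ u₃ ∧ (u₁ ≠ a ∧ Contains R x₁ y₁ a ∧ Contains R x₁ y₁ u₁) ∧
    (u₂ ≠ a ∧ Contains R x₂ y₂ a ∧ Contains R x₂ y₂ u₂) ∧
    (u₃ ≠ a ∧ Contains R x₃ y₃ a ∧ Contains R x₃ y₃ u₃)

/-- The line through `x` and `y` is coplanar with a line disjoint from it. -/
def HasParallel (x y : S) : Prop :=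
  ∃ u v w, ¬ R x y u ∧ v ≠ u ∧ v ≠ x ∧ w ≠ u ∧ w ≠ y ∧ R u x v ∧ R u y w ∧ Adj R v w ∧
    ¬ ∃ z, R x y z ∧ R v w z

/-- Collinearity on a line without a parallel. -/
def ProperCol (x y z : S) : Prop :=
  R x y z ∧ (x ≠ y → ¬ HasParallel R x y) ∧ (x ≠ z → ¬ HasParallel R x z) ∧
    (y ≠ z → ¬ HasParallel R y z)

end Relations

/-! ### Geometric meaning of adjacency and of `Par` -/

namespace PolarSpace

variable {Q : Type*} {𝔔 : PolarSpace Q}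

variable (𝔔) in
/-- The strong subspaces of rank `n + 1` outside the hyperplane. -/
abbrev El (H : Set Q) (n : ℕ) : Type _ := {X : Set Q // 𝔔.Rk X (n + 1) ∧ ¬ X ⊆ H}

variable (𝔔) in
/-- Collinearity in the space of pencils over the affine polar space. -/
def affCol (H : Set Q) (n : ℕ) (X Y Z : 𝔔.El H n) : Prop :=
  ∃ C B, 𝔔.Rk C n ∧ 𝔔.Rk B (n + 2) ∧ ¬ C ⊆ H ∧ (C ⊆ X.1 ∧ C ⊆ Y.1 ∧ C ⊆ Z.1) ∧
    X.1 ⊆ B ∧ Y.1 ⊆ B ∧ Z.1 ⊆ B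

variable (𝔔) in
/-- Collinearity in the extended space of pencils over the affine polar space. -/
def affColExt (H : Set Q) (n : ℕ) (X Y Z : 𝔔.El H n) : Prop :=
  ∃ C B, 𝔔.Rk C n ∧ 𝔔.Rk B (n + 2) ∧ (C ⊆ X.1 ∧ C ⊆ Y.1 ∧ C ⊆ Z.1) ∧
    X.1 ⊆ B ∧ Y.1 ⊆ B ∧ Z.1 ⊆ B

variable {H : Set Q} {n : ℕ}

theorem affCol.ext {X Y Z : 𝔔.El H n} (h : 𝔔.affCol H n X Y Z) : 𝔔.affColExt H n X Y Z :=
  let ⟨C, B, hC, hB, _, h⟩ := h; ⟨C, B, hC, hB, h⟩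

theorem affColExt.base (hf : 𝔔.FiniteRank) {X Y Z : 𝔔.El H n} (h : 𝔔.affColExt H n X Y Z)
    (hXY : X ≠ Y) : 𝔔.Rk (X.1 ∩ Y.1) n ∧ X.1 ∩ Y.1 ⊆ Z.1 ∧ 𝔔.PerpSets X.1 Y.1 := by
  obtain ⟨C, B, hC, hB, ⟨h1, h2, h3⟩, h4, h5, h6⟩ := h
  have := hC.inter_eq hf X.2.1 Y.2.1 h1 h2 (fun h => hXY (Subtype.ext h))
  rw [this]
  exact ⟨hC, h3, perpSets_of_subset hB.isStrong h4 h5⟩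

theorem affColExt.subset (hf : 𝔔.FiniteRank) {X Y Z : 𝔔.El H n} (h : 𝔔.affColExt H n X Y Z)
    (hXY : X ≠ Y) {T : Set Q} (hT : 𝔔.IsSubspace T) (hX : X.1 ⊆ T) (hY : Y.1 ⊆ T) : Z.1 ⊆ T := by
  obtain ⟨C, B, hC, hB, ⟨h1, h2, h3⟩, h4, h5, h6⟩ := h
  exact h6.trans (X.2.1.subset_of_ne hf Y.2.1 hB h4 h5 (fun h => hXY (Subtype.ext h)) hT hX hY)

theorem affCol.base_not_subset (hf : 𝔔.FiniteRank) {X Y Z : 𝔔.El H n} (h : 𝔔.affCol H n X Y Z)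
    (hXY : X ≠ Y) : ¬ X.1 ∩ Y.1 ⊆ H := by
  obtain ⟨C, B, hC, hB, hCH, ⟨h1, h2, h3⟩, h4, h5, h6⟩ := h
  rwa [hC.inter_eq hf X.2.1 Y.2.1 h1 h2 (fun h => hXY (Subtype.ext h))]

theorem adj_affColExt_iff (hf : 𝔔.FiniteRank) {X Y : 𝔔.El H n} :
    Adj (𝔔.affColExt H n) X Y ↔
      X ≠ Y ∧ 𝔔.Rk (X.1 ∩ Y.1) n ∧ 𝔔.PerpSets X.1 Y.1 := by
  constructor
  · rintro ⟨hne, h⟩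
    obtain ⟨h1, -, h2⟩ := h.base hf hne
    exact ⟨hne, h1, h2⟩
  · rintro ⟨hne, hC, hp⟩
    obtain ⟨B, hB, h1, h2⟩ := hC.exists_span hf X.2.1 Y.2.1 Set.inter_subset_left
      Set.inter_subset_right (fun h => hne (Subtype.ext h)) hp
    exact ⟨hne, _, B, hC, hB, ⟨Set.inter_subset_left, Set.inter_subset_right,
      Set.inter_subset_right⟩, h1, h2, h2⟩

theorem adj_affCol_iff (hf : 𝔔.FiniteRank) {X Y : 𝔔.El H n} :
    Adj (𝔔.affCol H n) X Y ↔
      X ≠ Y ∧ 𝔔.Rk (X.1 ∩ Y.1) n ∧ 𝔔.PerpSets X.1 Y.1 ∧ ¬ X.1 ∩ Y.1 ⊆ H := by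
  constructor
  · rintro ⟨hne, h⟩
    obtain ⟨h1, -, h2⟩ := h.ext.base hf hne
    exact ⟨hne, h1, h2, h.base_not_subset hf hne⟩
  · rintro ⟨hne, hC, hp, hCH⟩
    obtain ⟨B, hB, h1, h2⟩ := hC.exists_span hf X.2.1 Y.2.1 Set.inter_subset_left
      Set.inter_subset_right (fun h => hne (Subtype.ext h)) hp
    exact ⟨hne, _, B, hC, hB, hCH, ⟨Set.inter_subset_left, Set.inter_subset_right,
      Set.inter_subset_right⟩, h1, h2, h2⟩

theorem Rk.adj (hf : 𝔔.FiniteRank) {X Y : 𝔔.El H n} {C : Set Q} (hC : 𝔔.Rk C n) (hCX : C ⊆ X.1)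
    (hCY : C ⊆ Y.1) (hCH : ¬ C ⊆ H) (hne : X ≠ Y) (hp : 𝔔.PerpSets X.1 Y.1) :
    Adj (𝔔.affCol H n) X Y := by
  have := hC.inter_eq hf X.2.1 Y.2.1 hCX hCY (fun h => hne (Subtype.ext h))
  exact (adj_affCol_iff hf).2 ⟨hne, this ▸ hC, hp, this ▸ hCH⟩

theorem _root_.Adj.symm_affCol {X Y : 𝔔.El H n} (hf : 𝔔.FiniteRank) (h : Adj (𝔔.affCol H n) X Y) :
    Adj (𝔔.affCol H n) Y X := by
  rw [adj_affCol_iff hf] at h ⊢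
  obtain ⟨h1, h2, h3, h4⟩ := h
  exact ⟨h1.symm, Set.inter_comm X.1 Y.1 ▸ h2, h3.symm, Set.inter_comm X.1 Y.1 ▸ h4⟩

/-- A common neighbour of `X` and `Y` is collinear with both and meets both in corank one. -/
theorem _root_.CommonNbr.spec (hf : 𝔔.FiniteRank) {X Y U : 𝔔.El H n}
    (h : CommonNbr (𝔔.affCol H n) X Y U) :
    𝔔.Rk (U.1 ∩ X.1) n ∧ ¬ U.1 ∩ X.1 ⊆ H ∧ 𝔔.PerpSets U.1 X.1 ∧
    𝔔.Rk (U.1 ∩ Y.1) n ∧ ¬ U.1 ∩ Y.1 ⊆ H ∧ 𝔔.PerpSets U.1 Y.1 := by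
  obtain ⟨h1, h2⟩ := h
  rw [adj_affCol_iff hf] at h1 h2
  exact ⟨h1.2.1, h1.2.2.2, h1.2.2.1, h2.2.1, h2.2.2.2, h2.2.2.1⟩

theorem _root_.CommonNbr.subset (hf : 𝔔.FiniteRank) {X Y U : 𝔔.El H n}
    (h : CommonNbr (𝔔.affCol H n) X Y U) (hXY : U.1 ∩ X.1 ≠ U.1 ∩ Y.1) {T : Set Q}
    (hT : 𝔔.IsSubspace T) (hX : X.1 ⊆ T) (hY : Y.1 ⊆ T) : U.1 ⊆ T := by
  obtain ⟨h1, -, -, h2, -, -⟩ := h.spec hf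
  exact h1.subset_of_ne hf h2 U.2.1 Set.inter_subset_left Set.inter_subset_left hXY hT
    (Set.inter_subset_right.trans hX) (Set.inter_subset_right.trans hY)

/-- Let `B` be the span of the line through `X`, `U`, `V`; since `U` and `V` are collinear with `Y`,
so is `B`. Were `U` and `V` to meet `Y` in the same subspace, it would be the bottom of their pencil
and `X`, `Y` would be adjacent. So `Y ⊆ B`, and non-adjacency forces `X ∩ Y` into `H`. Conversely, a
pencil in the span of `X` and `Y`, through `X` and with bottom outside `H`, consists apart from `X`
of common neighbours. -/
theorem par_affCol_iff (hf : 𝔔.FiniteRank) (hH : 𝔔.IsHyperplane H) (hn : 1 ≤ n)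
    {X Y : 𝔔.El H n} :
    Par (𝔔.affCol H n) X Y ↔
      X ≠ Y ∧ 𝔔.Rk (X.1 ∩ Y.1) n ∧ 𝔔.PerpSets X.1 Y.1 ∧ X.1 ∩ Y.1 ⊆ H := by
  constructor
  · rintro ⟨hne, hna, U, V, hUV, hU, hV, hc⟩
    have hUX := hU.1
    have hXU : X ≠ U := fun h => hUX.1 h.symm
    obtain ⟨C, B, hC, hB, hCH, ⟨hCX, hCU, hCV⟩, hXB, hUB, hVB⟩ := hc
    have hUV' : U.1 ≠ V.1 := fun h => hUV (Subtype.ext h)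
    obtain ⟨hU1, hU1H, hUp, hU2, hU2H, hUp2⟩ := hU.spec hf
    obtain ⟨hV1, hV1H, hVp, hV2, hV2H, hVp2⟩ := hV.spec hf
    have hBY : 𝔔.PerpSets B Y.1 := U.2.1.perpSets_of_ne hf V.2.1 hB hUB hVB hUV' hUp2 hVp2
    have hXY : 𝔔.PerpSets X.1 Y.1 := hBY.mono hXB subset_rfl
    by_cases hne2 : U.1 ∩ Y.1 = V.1 ∩ Y.1
    · have h1 : U.1 ∩ Y.1 ⊆ U.1 ∩ V.1 := Set.subset_inter Set.inter_subset_left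
        (hne2 ▸ Set.inter_subset_left)
      rw [hC.inter_eq hf U.2.1 V.2.1 hCU hCV hUV'] at h1
      have h2 := hU2.eq_of_subset hC h1
      exact absurd (hC.adj hf hCX (h2 ▸ Set.inter_subset_right) hCH hne hXY) hna
    · have hYB : Y.1 ⊆ B := hU2.subset_of_ne hf hV2 Y.2.1 Set.inter_subset_right
        Set.inter_subset_right hne2 hB.isStrong.1 (Set.inter_subset_left.trans hUB)
        (Set.inter_subset_left.trans hVB)
      have h1 := X.2.1.inter_of_ne hf Y.2.1 hB hXB hYB (fun h => hne (Subtype.ext h))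
      refine ⟨hne, h1, hXY, ?_⟩
      by_contra h2
      exact hna ((adj_affCol_iff hf).2 ⟨hne, h1, hXY, h2⟩)
  · rintro ⟨hne, hE, hp, hEH⟩
    refine ⟨hne, fun h => ((adj_affCol_iff hf).1 h).2.2.2 hEH, ?_⟩
    obtain ⟨B, hB, hXB, hYB⟩ := hE.exists_span hf X.2.1 Y.2.1 Set.inter_subset_left
      Set.inter_subset_right (fun h => hne (Subtype.ext h)) hp
    obtain ⟨x, hx, hxH⟩ := Set.not_subset.1 X.2.2
    obtain ⟨C, hC, hxC, hCX⟩ := exists_between hf (rk_singleton hf x) X.2.1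
      (Set.singleton_subset_iff.2 hx) hn (Nat.le_succ n)
    have hCH : ¬ C ⊆ H := fun h => hxH (h (hxC rfl))
    obtain ⟨U, V, hU, hV, hCU, hCV, hUB, hVB, hUV, hUX, hVX⟩ :=
      exists_pencil_ne hf hC X.2.1 hB hCX hXB
    have key : ∀ (W : Set Q) (hW : 𝔔.Rk W (n + 1)) (hCW : C ⊆ W), W ⊆ B → W ≠ X.1 →
        CommonNbr (𝔔.affCol H n) X Y ⟨W, hW, fun h => hCH (hCW.trans h)⟩ := by
      intro W hW hCW hWB hWX
      -- `X ∩ Y` is all of `Y ∩ H`, so `W` could fail to be adjacent to `Y` only by containing `X ∩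
      -- Y`; then `X ∩ Y` would be `C`, which is not inside `H`.
      have hYH := hH.inter_eq hf Y.2.1 Y.2.2 hE Set.inter_subset_right hEH
      have hWX' := hC.inter_eq hf hW X.2.1 hCW hCX hWX
      have hEC : ¬ X.1 ∩ Y.1 ⊆ W := fun h => by
        have h1 : X.1 ∩ Y.1 ⊆ C := hWX' ▸ Set.subset_inter h Set.inter_subset_left
        exact hCH (hE.eq_of_subset hC h1 ▸ hEH)
      have hWY : W ≠ Y.1 := by rintro rfl; exact hEC Set.inter_subset_right
      refine ⟨hC.adj hf hCW hCX hCH (fun h => hWX (congrArg Subtype.val h))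
        (perpSets_of_subset hB.isStrong hWB hXB), ?_⟩
      have h1 := hW.inter_of_ne hf Y.2.1 hB hWB hYB hWY
      refine (adj_affCol_iff hf).2 ⟨fun h => hWY (congrArg Subtype.val h), h1,
        perpSets_of_subset hB.isStrong hWB hYB, fun h2 => hEC ?_⟩
      rw [← hYH, hH.inter_eq hf Y.2.1 Y.2.2 h1 Set.inter_subset_right h2]
      exact Set.inter_subset_left
    exact ⟨_, _, fun h => hUV (congrArg Subtype.val h), key U hU hCU hUB hUX,
      key V hV hCV hVB hVX, C, B, hC, hB, hCH, ⟨hCX, hCU, hCV⟩, hXB, hUB, hVB⟩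

theorem _root_.CommonNbr.base_subset (hf : 𝔔.FiniteRank) {X Y U : 𝔔.El H n}
    (h : CommonNbr (𝔔.affCol H n) X Y U) {C : Set Q} (hCX : C ⊆ X.1)
    (hCY : C ⊆ Y.1) (hp : ¬ 𝔔.PerpSets X.1 Y.1) : C ⊆ U.1 := by
  obtain ⟨h1, -, -, -, -, h2⟩ := h.spec hf
  by_contra hCU
  obtain ⟨c, hc, hcU⟩ := Set.not_subset.1 hCU
  exact hp (h1.perpSets_of_mem hf X.2.1 Set.inter_subset_right (hCX hc) (fun h => hcU h.1)
    (h2.mono Set.inter_subset_left subset_rfl) fun y hy => Y.2.1.isStrong.2 y hy c (hCY hc))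

/-- In the residue of `C`: the line through `X` and `Z` has a point collinear with `Y`. -/
theorem exists_commonNbr (hf : 𝔔.FiniteRank) {X Y : 𝔔.El H n} {C Z : Set Q} (hC : 𝔔.Rk C n)
    (hCX : C ⊆ X.1) (hCY : C ⊆ Y.1) (hCH : ¬ C ⊆ H) (hp : ¬ 𝔔.PerpSets X.1 Y.1)
    (hZ : 𝔔.Rk Z (n + 1)) (hCZ : C ⊆ Z) (hXZ : 𝔔.PerpSets X.1 Z) (hne : X.1 ≠ Z) :
    ∃ U : 𝔔.El H n, CommonNbr (𝔔.affCol H n) X Y U ∧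
      ∃ B, 𝔔.Rk B (n + 2) ∧ X.1 ⊆ B ∧ Z ⊆ B ∧ U.1 ⊆ B := by
  obtain ⟨B, hB, hXB, hZB⟩ := hC.exists_span hf X.2.1 hZ hCX hCZ hne hXZ
  obtain ⟨x, hx, hxC⟩ := Set.not_subset.1 (hC.not_subset X.2.1 (Nat.lt_succ_self n))
  obtain ⟨y, hy, hyC⟩ := Set.not_subset.1 (hC.not_subset Y.2.1 (Nat.lt_succ_self n))
  obtain ⟨z, hz, hzX⟩ := Set.not_subset.1
    (fun h => hne (hZ.eq_of_subset X.2.1 h).symm : ¬ Z ⊆ X.1)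
  have hxy : ¬ 𝔔.Perp x y := fun h => hp <| by
    have h1 : 𝔔.PerpSets Y.1 {x} := hC.perpSets_of_mem hf Y.2.1 hCY hy hyC
      (by rintro c hc _ rfl; exact X.2.1.isStrong.2 c (hCX hc) _ hx)
      (by rintro _ rfl; exact h)
    exact hC.perpSets_of_mem hf X.2.1 hCX hx hxC
      (perpSets_of_subset Y.2.1.isStrong hCY subset_rfl) (fun y hy => h1 y hy x rfl)
  have hxz : x ≠ z := by rintro rfl; exact hzX hx
  obtain ⟨w, hw, hyw⟩ := exists_col_perp (hXZ x hx z hz) hxz y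
  have hwx : x ≠ w := by rintro rfl; exact hxy hyw.symm
  have hwX : w ∉ X.1 := fun h => hzX (X.2.1.isStrong.1.col hx h hwx hw.swap')
  have hwB := hB.isStrong.1.col (hXB hx) (hZB hz) hxz hw
  have hU := hC.join hf (a := w) (fun c hc => hB.isStrong.2 c (hXB (hCX hc)) w hwB)
    (fun h => hwX (hCX h))
  have hCU := subset_join (𝔔 := 𝔔) C w
  have hUB : 𝔔.join C w ⊆ B := join_subset hB.isStrong.1 (hCX.trans hXB) hwB
  have hUX : 𝔔.join C w ≠ X.1 := fun h => hwX (h ▸ mem_join C w)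
  have hUp : 𝔔.PerpSets (𝔔.join C w) Y.1 := by
    refine hC.perpSets_of_mem hf hU hCU (mem_join C w) (fun h => hwX (hCX h))
      (perpSets_of_subset Y.2.1.isStrong hCY subset_rfl) ?_
    have h1 : 𝔔.PerpSets Y.1 {w} := hC.perpSets_of_mem hf Y.2.1 hCY hy hyC
      (by rintro c hc _ rfl; exact hB.isStrong.2 c (hXB (hCX hc)) _ hwB)
      (by rintro _ rfl; exact hyw.symm)
    exact fun y hy => h1 y hy w rfl
  have hUY : 𝔔.join C w ≠ Y.1 := fun h => hp fun a ha b hb =>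
    hB.isStrong.2 a (hXB ha) b (hUB (h ▸ hb))
  exact ⟨⟨_, hU, fun h => hCH (hCU.trans h)⟩,
    ⟨hC.adj hf hCU hCX hCH (fun h => hUX (congrArg Subtype.val h))
      (perpSets_of_subset hB.isStrong hUB hXB),
     hC.adj hf hCU hCY hCH (fun h => hUY (congrArg Subtype.val h)) hUp⟩, B, hB, hXB, hZB, hUB⟩

end PolarSpace

/-! ### Recognising subspaces of corank one: `Share` and `Contains` -/

namespace PolarSpace

variable {Q : Type*} {𝔔 : PolarSpace Q}

variable {H : Set Q} {n m : ℕ}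

/-- Extending `X` in different directions gives different common neighbours through `C`. No two of
them can be adjacent to a parallel `Z` of `Y`: both would lie in the span `B` of `Z` and `Y`, hence
span it, making `B`, and so `Y`, collinear with `X`. -/
theorem share_of_subset (hm : 𝔔.HasIndex m) (hnm : n + 1 ≤ m) (hH : 𝔔.IsHyperplane H) (hn : 1 ≤ n)
    {X Y : 𝔔.El H n} {C : Set Q} (hC : 𝔔.Rk C n) (hCX : C ⊆ X.1) (hCY : C ⊆ Y.1) (hCH : ¬ C ⊆ H)
    (hp : ¬ 𝔔.PerpSets X.1 Y.1) : Share (𝔔.affCol H n) X Y := by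
  have hf := hm.finiteRank
  have hne : X ≠ Y := by
    rintro rfl
    exact hp fun a ha b hb => X.2.1.isStrong.2 a ha b hb
  refine ⟨hne, fun h => hp ((adj_affCol_iff hf).1 h).2.2.1, ?_, ?_⟩
  · obtain ⟨a, ha, haX⟩ := X.2.1.exists_mem_orth hm hnm
    have mk : ∀ b ∈ 𝔔.orth X.1, b ∉ X.1 → ∃ U : 𝔔.El H n, CommonNbr (𝔔.affCol H n) X Y U ∧
        ∃ B, 𝔔.Rk B (n + 2) ∧ X.1 ⊆ B ∧ b ∈ B ∧ U.1 ⊆ B := by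
      intro b hb hbX
      have hbC : b ∉ C := fun h => hbX (hCX h)
      have hZ := hC.join hf (a := b) (fun x hx => hb x (hCX hx)) hbC
      obtain ⟨U, hU, B, hB, hXB, hZB, hUB⟩ := exists_commonNbr hf hC hCX hCY hCH hp hZ
        (subset_join C b) (fun x hx z hz => by
          have : 𝔔.join C b ⊆ 𝔔.orth X.1 := join_subset (isSubspace_orth _)
            (fun c hc x hx => X.2.1.isStrong.2 x hx c (hCX hc)) hb
          exact this hz x hx) (fun h => hbX (h ▸ mem_join C b))
      exact ⟨U, hU, B, hB, hXB, hZB (mem_join C b), hUB⟩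
    obtain ⟨U, hU, -⟩ := mk a ha haX
    have hUX : ¬ U.1 ⊆ X.1 := fun h => hU.1.1 (Subtype.ext (U.2.1.eq_of_subset X.2.1 h))
    obtain ⟨u, hu, huX⟩ := Set.not_subset.1 hUX
    have hUp := (hU.spec hf).2.2.1
    -- Choosing `b` not collinear with a point `u` of `U` guarantees that the neighbour built from
    -- `b` differs from `U`.
    obtain ⟨b, hb, hbu⟩ := exists_separating hf X.2.1.isStrong (a := u)
      (fun x hx => (hUp u hu x hx).symm) huX
    have hbX : b ∉ X.1 := fun h => hbu (hUp u hu b h).symm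
    obtain ⟨V, hV, B, hB, hXB, hbB, hVB⟩ := mk b hb hbX
    refine ⟨U, V, ?_, hU, hV⟩
    rintro rfl
    exact hbu (hB.isStrong.2 b hbB u (hVB hu))
  · rintro ⟨U, V, Z, hUV, hU, hV, hZ, hZU, hZV⟩
    obtain ⟨hZY, hE, hZp, hEH⟩ := (par_affCol_iff hf hH hn).1 hZ
    obtain ⟨B, hB, hZB, hYB⟩ := hE.exists_span hf Z.2.1 Y.2.1 Set.inter_subset_left
      Set.inter_subset_right (fun h => hZY (Subtype.ext h)) hZp
    have key : ∀ W : 𝔔.El H n, CommonNbr (𝔔.affCol H n) X Y W → Adj (𝔔.affCol H n) Z W →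
        W.1 ⊆ B := by
      intro W hW hZW
      have hN : CommonNbr (𝔔.affCol H n) Z Y W := ⟨hZW.symm_affCol hf, hW.2⟩
      refine hN.subset hf (fun h => ?_) hB.isStrong.1 hZB hYB
      obtain ⟨-, h1, -⟩ := hN.spec hf
      exact h1 ((Set.subset_inter Set.inter_subset_right (h ▸ Set.inter_subset_right)).trans hEH)
    have h1 : 𝔔.PerpSets B X.1 := U.2.1.perpSets_of_ne hf V.2.1 hB (key U hU hZU) (key V hV hZV)
      (fun h => hUV (Subtype.ext h)) (hU.spec hf).2.2.1 (hV.spec hf).2.2.1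
    exact hp (h1.mono hYB subset_rfl).symm

/-- A common neighbour meeting `X` and `Y` in the same subspace exhibits the base at once. If `U`
and `V` both meet them in different subspaces, then `X` and `Y` must be mutually collinear, and a
parallel `Z` of `Y` adjacent to two distinct common neighbours contradicts the last clause of
`Share`. -/
theorem _root_.Share.exists_base (hf : 𝔔.FiniteRank) (hH : 𝔔.IsHyperplane H) (hn : 1 ≤ n)
    {X Y : 𝔔.El H n} (h : Share (𝔔.affCol H n) X Y) :
    𝔔.Rk (X.1 ∩ Y.1) n ∧ ¬ X.1 ∩ Y.1 ⊆ H ∧ ¬ 𝔔.PerpSets X.1 Y.1 := by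
  obtain ⟨hne, hna, ⟨U, V, hUV, hU, hV⟩, hno⟩ := h
  have hne' : X.1 ≠ Y.1 := fun h => hne (Subtype.ext h)
  have fin : ∀ W : 𝔔.El H n, CommonNbr (𝔔.affCol H n) X Y W → W.1 ∩ X.1 = W.1 ∩ Y.1 →
      𝔔.Rk (X.1 ∩ Y.1) n ∧ ¬ X.1 ∩ Y.1 ⊆ H ∧ ¬ 𝔔.PerpSets X.1 Y.1 := by
    intro W hW heq
    obtain ⟨h1, h2, -⟩ := hW.spec hf
    have h3 : W.1 ∩ X.1 ⊆ Y.1 := heq ▸ Set.inter_subset_right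
    have h4 := h1.inter_eq hf X.2.1 Y.2.1 Set.inter_subset_right h3 hne'
    exact ⟨h4 ▸ h1, h4 ▸ h2, fun hp =>
      hna ((adj_affCol_iff hf).2 ⟨hne, h4 ▸ h1, hp, h4 ▸ h2⟩)⟩
  by_cases hUe : U.1 ∩ X.1 = U.1 ∩ Y.1
  · exact fin U hU hUe
  by_cases hVe : V.1 ∩ X.1 = V.1 ∩ Y.1
  · exact fin V hV hVe
  exfalso
  obtain ⟨hU1, hU1H, hUp, hU2, hU2H, hUp2⟩ := hU.spec hf
  obtain ⟨hV1, hV1H, hVp, hV2, hV2H, hVp2⟩ := hV.spec hf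
  by_cases hp : 𝔔.PerpSets X.1 Y.1
  swap
  -- Without mutual collinearity, `U ∩ X` is the largest part of `X` collinear with `Y`, and
  -- likewise for `U ∩ Y`. Both are the same for `V`, and they span `U`, so `U = V`.
  · refine hUV (Subtype.ext (U.2.1.eq_of_subset V.2.1 ?_))
    have e1 : U.1 ∩ X.1 = V.1 ∩ X.1 := by
      by_contra h
      exact hp (hU1.perpSets_of_ne hf hV1 X.2.1 Set.inter_subset_right Set.inter_subset_right h
        (hUp2.mono Set.inter_subset_left subset_rfl) (hVp2.mono Set.inter_subset_left subset_rfl))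
    have e2 : U.1 ∩ Y.1 = V.1 ∩ Y.1 := by
      by_contra h
      exact hp (hU2.perpSets_of_ne hf hV2 Y.2.1 Set.inter_subset_right Set.inter_subset_right h
        (hUp.mono Set.inter_subset_left subset_rfl)
        (hVp.mono Set.inter_subset_left subset_rfl)).symm
    exact hU1.subset_of_ne hf hU2 U.2.1 Set.inter_subset_left Set.inter_subset_left hUe
      V.2.1.isStrong.1 (e1 ▸ Set.inter_subset_left) (e2 ▸ Set.inter_subset_left)
  have hrk : ¬ 𝔔.Rk (X.1 ∩ Y.1) n := by
    intro hE
    by_cases hEH : X.1 ∩ Y.1 ⊆ H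
    · exact hno ⟨U, V, X, hUV, hU, hV, (par_affCol_iff hf hH hn).2 ⟨hne, hE, hp, hEH⟩,
        hU.1.symm_affCol hf, hV.1.symm_affCol hf⟩
    · exact hna ((adj_affCol_iff hf).2 ⟨hne, hE, hp, hEH⟩)
  -- `B` is spanned by `U` and `Y`; the pencil `p(U ∩ X, B)` contains a second common neighbour.
  obtain ⟨B, hB, hUB, hYB⟩ := hU2.exists_span hf U.2.1 Y.2.1 Set.inter_subset_left
    Set.inter_subset_right (fun h => hU.2.1 (Subtype.ext h)) hUp2
  have hCY : ¬ U.1 ∩ X.1 ⊆ Y.1 := fun h =>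
    hrk ((hU1.inter_eq hf X.2.1 Y.2.1 Set.inter_subset_right h hne') ▸ hU1)
  have hXB : ¬ X.1 ⊆ B := fun h => hrk (X.2.1.inter_of_ne hf Y.2.1 hB h hYB hne')
  -- `E` is the part at infinity of `Y`. Elements of `B` not containing `E` meet `Y`, and every
  -- parallel of `Y` inside `B`, outside `H`, so they are adjacent to these.
  obtain ⟨E, hEdef⟩ : ∃ E, E = Y.1 ∩ H := ⟨_, rfl⟩
  have hE : 𝔔.Rk E n := hEdef ▸ hH.rk_inter hf Y.2.1 Y.2.2
  have hEY : E ⊆ Y.1 := hEdef ▸ Set.inter_subset_left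
  have hEH : E ⊆ H := hEdef ▸ Set.inter_subset_right
  have key : ∀ (W : Set Q) (hW : 𝔔.Rk W (n + 1)) (hCW : U.1 ∩ X.1 ⊆ W), W ⊆ B → ¬ E ⊆ W →
      CommonNbr (𝔔.affCol H n) X Y ⟨W, hW, fun h => hU1H (hCW.trans h)⟩ := by
    intro W hW hCW hWB hEW
    have hWX : W ≠ X.1 := by rintro rfl; exact hXB hWB
    have hWY : W ≠ Y.1 := by rintro rfl; exact hCY hCW
    have hBX : 𝔔.PerpSets B X.1 := U.2.1.perpSets_of_ne hf Y.2.1 hB hUB hYB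
      (fun h => hU.2.1 (Subtype.ext h)) hUp hp.symm
    refine ⟨hU1.adj hf hCW Set.inter_subset_right hU1H (fun h => hWX (congrArg Subtype.val h))
      (hBX.mono hWB subset_rfl), ?_⟩
    have h1 := hW.inter_of_ne hf Y.2.1 hB hWB hYB hWY
    refine (adj_affCol_iff hf).2 ⟨fun h => hWY (congrArg Subtype.val h), h1,
      perpSets_of_subset hB.isStrong hWB hYB, fun h2 => hEW ?_⟩
    have h3 := hH.inter_eq hf Y.2.1 Y.2.2 h1 Set.inter_subset_right h2
    rw [← hEdef] at h3
    exact h3 ▸ Set.inter_subset_left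
  have hEU : ¬ E ⊆ U.1 := fun h => by
    have := hE.eq_of_subset hU2 (Set.subset_inter h hEY)
    exact hU2H (this ▸ hEH)
  obtain ⟨V', hV', hCV', hV'B, hV'U, hEV'⟩ : ∃ V', 𝔔.Rk V' (n + 1) ∧ U.1 ∩ X.1 ⊆ V' ∧ V' ⊆ B ∧
      V' ≠ U.1 ∧ ¬ E ⊆ V' := by
    obtain ⟨W, W', hW, hW', hCW, hCW', hWB, hWB', hne, h1, h2⟩ :=
      exists_pencil_ne hf hU1 U.2.1 hB Set.inter_subset_left hUB
    by_cases hEW : E ⊆ W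
    · refine ⟨W', hW', hCW', hWB', h2, fun hEW' => hCY ?_⟩
      have h3 : E ⊆ U.1 ∩ X.1 :=
        hU1.inter_eq hf hW hW' hCW hCW' hne ▸ Set.subset_inter hEW hEW'
      exact hE.eq_of_subset hU1 h3 ▸ hEY
    · exact ⟨W, hW, hCW, hWB, h1, hEW⟩
  have hBH : ¬ B ⊆ H := fun h => Y.2.2 (hYB.trans h)
  -- At most one member of the pencil lies in `H`, namely `B ∩ H`, so one of the two further members
  -- serves as a parallel of `Y`.
  obtain ⟨Z, hZ, hEZ, hZB, hZY, hZH⟩ : ∃ Z, 𝔔.Rk Z (n + 1) ∧ E ⊆ Z ∧ Z ⊆ B ∧ Z ≠ Y.1 ∧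
      ¬ Z ⊆ H := by
    obtain ⟨W, W', hW, hW', hCW, hCW', hWB, hWB', hne, h1, h2⟩ :=
      exists_pencil_ne hf hE Y.2.1 hB hEY hYB
    by_cases hWH : W ⊆ H
    · refine ⟨W', hW', hCW', hWB', h2, fun hWH' => hne ?_⟩
      exact (hH.inter_eq hf hB hBH hW hWB hWH).symm.trans (hH.inter_eq hf hB hBH hW' hWB' hWH')
    · exact ⟨W, hW, hCW, hWB, h1, hWH⟩
  have hZE : Z ∩ Y.1 = E := hE.inter_eq hf hZ Y.2.1 hEZ hEY hZY
  have hZH' : Z ∩ H = E := hH.inter_eq hf hZ hZH hE hEZ hEH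
  have adjZ : ∀ W : 𝔔.El H n, W.1 ⊆ B → ¬ E ⊆ W.1 → Adj (𝔔.affCol H n) ⟨Z, hZ, hZH⟩ W := by
    intro W hWB hEW
    have hZW : Z ≠ W.1 := by rintro h; exact hEW (h ▸ hEZ)
    have h1 := hZ.inter_of_ne hf W.2.1 hB hZB hWB hZW
    refine (adj_affCol_iff hf).2 ⟨fun h => hZW (congrArg Subtype.val h), h1,
      perpSets_of_subset hB.isStrong hZB hWB, fun h2 => hEW ?_⟩
    have h3 := hH.inter_eq hf hZ hZH h1 Set.inter_subset_left h2
    rw [hZH'] at h3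
    exact h3 ▸ Set.inter_subset_right
  refine hno ⟨U, _, ⟨Z, hZ, hZH⟩, fun h => hV'U (congrArg Subtype.val h).symm, hU,
    key V' hV' hCV' hV'B hEV', (par_affCol_iff hf hH hn).2 ⟨fun h => hZY (congrArg Subtype.val h),
      ?_, perpSets_of_subset hB.isStrong hZB hYB, ?_⟩, adjZ U hUB hEU, adjZ _ hV'B hEV'⟩
  · exact hZE ▸ hE
  · exact hZE ▸ hEH

/-- Common neighbours of `X` and `Y` contain the base `C`, because the base is collinear with `X`
and `Y`, which are not mutually collinear; hence so does every line joining them to `X`. Such lines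
reach all elements above `C` that are collinear with `X`. An element `A` above `C` not collinear
with `X` is reached through a common neighbour `V` of `A` and `X`, which is the second alternative
in `Contains`. -/
theorem contains_iff (hm : 𝔔.HasIndex m) (hnm : n + 1 ≤ m) (hH : 𝔔.IsHyperplane H) (hn : 1 ≤ n)
    {X Y A : 𝔔.El H n} (h : Share (𝔔.affCol H n) X Y) :
    Contains (𝔔.affCol H n) X Y A ↔ X.1 ∩ Y.1 ⊆ A.1 := by
  have hf := hm.finiteRank
  obtain ⟨hC, hCH, hp⟩ := h.exists_base hf hH hn
  have hCX : X.1 ∩ Y.1 ⊆ X.1 := Set.inter_subset_left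
  have hCY : X.1 ∩ Y.1 ⊆ Y.1 := Set.inter_subset_right
  constructor
  · rintro ⟨U, V, hU, hc, hVA⟩
    have hUC := hU.base_subset hf hCX hCY hp
    have hUX : X ≠ U := fun h => hU.1.1 h.symm
    have hVC : X.1 ∩ Y.1 ⊆ V.1 := by
      have := hC.inter_eq hf X.2.1 U.2.1 hCX hUC (fun h => hUX (Subtype.ext h))
      rw [← this]
      exact (hc.ext.base hf hUX).2.1
    rcases hVA with rfl | ⟨hS, hV⟩
    · exact hVC
    obtain ⟨hC', -, hp'⟩ := hS.exists_base hf hH hn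
    have h1 := hV.base_subset hf (C := A.1 ∩ X.1) Set.inter_subset_left Set.inter_subset_right hp'
    have h2 := hC.inter_eq hf V.2.1 X.2.1 hVC hCX (fun h => hV.2.1 (Subtype.ext h))
    have h3 := hC'.eq_of_subset hC (h2 ▸ Set.subset_inter h1 Set.inter_subset_right)
    exact h3 ▸ Set.inter_subset_left
  · intro hCA
    have step : ∀ Z : 𝔔.El H n, X.1 ∩ Y.1 ⊆ Z.1 → 𝔔.PerpSets X.1 Z.1 → X ≠ Z →
        ∃ U, CommonNbr (𝔔.affCol H n) X Y U ∧ 𝔔.affCol H n X U Z := by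
      intro Z hCZ hXZ hne
      obtain ⟨U, hU, B, hB, hXB, hZB, hUB⟩ := exists_commonNbr hf hC hCX hCY hCH hp Z.2.1 hCZ hXZ
        (fun h => hne (Subtype.ext h))
      exact ⟨U, hU, _, B, hC, hB, hCH, ⟨hCX, hU.base_subset hf hCX hCY hp, hCZ⟩, hXB, hUB, hZB⟩
    by_cases hXA : 𝔔.PerpSets X.1 A.1
    · by_cases hne : X = A
      · subst hne
        obtain ⟨-, -, ⟨U, -, -, hU, -⟩, -⟩ := h
        refine ⟨U, X, hU, ?_, Or.inl rfl⟩
        obtain ⟨C, B, h1, h2, h3, ⟨h4, h5, -⟩, h6, h7, -⟩ := hU.1.2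
        exact ⟨C, B, h1, h2, h3, ⟨h5, h4, h5⟩, h7, h6, h7⟩
      · obtain ⟨U, hU, hc⟩ := step A hCA hXA hne
        exact ⟨U, A, hU, hc, Or.inl rfl⟩
    · have hS := share_of_subset hm hnm hH hn hC hCA hCX hCH (fun h => hXA h.symm)
      obtain ⟨V, -, -, hV, -⟩ := hS.2.2.1
      have hVC := hV.base_subset hf hCA hCX (fun h => hXA h.symm)
      obtain ⟨U, hU, hc⟩ := step V hVC (hV.spec hf).2.2.2.2.2.symm (fun h => hV.2.1 h.symm)
      exact ⟨U, V, hU, hc, Or.inr ⟨hS, hV⟩⟩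

/-- Every affine subspace of rank `n` is the intersection of two elements related by `Share`. -/
theorem exists_share (hm : 𝔔.HasIndex m) (hnm : n + 1 ≤ m) (hH : 𝔔.IsHyperplane H) (hn : 1 ≤ n)
    {C : Set Q} (hC : 𝔔.Rk C n) (hCH : ¬ C ⊆ H) :
    ∃ X Y : 𝔔.El H n, Share (𝔔.affCol H n) X Y ∧ X.1 ∩ Y.1 = C := by
  have hf := hm.finiteRank
  obtain ⟨a, ha, haC⟩ := hC.exists_mem_orth hm (by omega)
  obtain ⟨b, hb, hba⟩ := exists_separating hf hC.isStrong ha haC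
  have hbC : b ∉ C := fun h => hba (ha b h)
  have hX := hC.join hf ha haC
  have hY := hC.join hf hb hbC
  have hp : ¬ 𝔔.PerpSets (𝔔.join C a) (𝔔.join C b) := fun h =>
    hba (h a (mem_join C a) b (mem_join C b)).symm
  have hS := share_of_subset hm hnm hH hn (X := ⟨_, hX, fun h => hCH ((subset_join C a).trans h)⟩)
    (Y := ⟨_, hY, fun h => hCH ((subset_join C b).trans h)⟩) hC (subset_join C a)
    (subset_join C b) hCH hp
  exact ⟨_, _, hS, hC.inter_eq hf hX hY (subset_join C a) (subset_join C b)
    (fun h => hS.1 (Subtype.ext h))⟩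

end PolarSpace

/-! ### Descent by one dimension; parallels detect pencils with bottom in the hyperplane -/

namespace PolarSpace

variable {Q : Type*} {𝔔 : PolarSpace Q}

variable {H : Set Q} {n m : ℕ}

/-- Each `Cᵢ` is `A ∩ Uᵢ`, so a line of elements `Uᵢ` with bottom `D` not inside `A` cuts `A` in
members of the pencil from `D ∩ A` to `A`, unless the `Cᵢ` all coincide. Conversely, a pencil with
top `A` is lifted to a line by adding a point outside `A`, which needs room for one more rank. -/
theorem stepCol_iff (hm : 𝔔.HasIndex m) (hnm : n + 2 ≤ m) (hH : 𝔔.IsHyperplane H)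
    {X₁ Y₁ X₂ Y₂ X₃ Y₃ : 𝔔.El H (n + 1)} (h₁ : Share (𝔔.affCol H (n + 1)) X₁ Y₁)
    (h₂ : Share (𝔔.affCol H (n + 1)) X₂ Y₂) (h₃ : Share (𝔔.affCol H (n + 1)) X₃ Y₃)
    {C₁ C₂ C₃ : 𝔔.El H n} (hC₁ : X₁.1 ∩ Y₁.1 = C₁.1) (hC₂ : X₂.1 ∩ Y₂.1 = C₂.1)
    (hC₃ : X₃.1 ∩ Y₃.1 = C₃.1) :
    StepCol (𝔔.affCol H (n + 1)) X₁ Y₁ X₂ Y₂ X₃ Y₃ ↔ 𝔔.affColExt H n C₁ C₂ C₃ := by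
  have hf := hm.finiteRank
  have hn : 1 ≤ n + 1 := by omega
  unfold StepCol
  simp only [contains_iff hm (by omega) hH hn h₁, contains_iff hm (by omega) hH hn h₂,
    contains_iff hm (by omega) hH hn h₃, hC₁, hC₂, hC₃]
  constructor
  · rintro ⟨A, U₁, U₂, U₃, ⟨D, B, hD, hB, -, ⟨hD1, hD2, hD3⟩, hB1, hB2, hB3⟩,
      ⟨ha1, hCA1, hCU1⟩, ⟨ha2, hCA2, hCU2⟩, ⟨ha3, hCA3, hCU3⟩⟩
    have e1 := C₁.2.1.inter_eq hf A.2.1 U₁.2.1 hCA1 hCU1 (fun h => ha1 (Subtype.ext h).symm)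
    have e2 := C₂.2.1.inter_eq hf A.2.1 U₂.2.1 hCA2 hCU2 (fun h => ha2 (Subtype.ext h).symm)
    have e3 := C₃.2.1.inter_eq hf A.2.1 U₃.2.1 hCA3 hCU3 (fun h => ha3 (Subtype.ext h).symm)
    have equal : C₁.1 = C₂.1 → C₁.1 = C₃.1 → 𝔔.affColExt H n C₁ C₂ C₃ := by
      intro h12 h13
      obtain ⟨D, hD, -, hDC⟩ := exists_between hf rk_empty C₁.2.1 (Set.empty_subset _)
        (Nat.zero_le n) (Nat.le_succ n)
      exact ⟨D, A.1, hD, A.2.1, ⟨hDC, h12 ▸ hDC, h13 ▸ hDC⟩, hCA1, hCA2, hCA3⟩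
    by_cases hDA : D ⊆ A.1
    · have f1 := hD.eq_of_subset C₁.2.1 (e1 ▸ Set.subset_inter hDA hD1)
      have f2 := hD.eq_of_subset C₂.2.1 (e2 ▸ Set.subset_inter hDA hD2)
      have f3 := hD.eq_of_subset C₃.2.1 (e3 ▸ Set.subset_inter hDA hD3)
      exact equal (f1.symm.trans f2) (f1.symm.trans f3)
    have fin : A.1 ⊆ B → 𝔔.affColExt H n C₁ C₂ C₃ := by
      intro hAB
      have h := A.2.1.inter hf hB hAB hD (hD1.trans hB1) hDA
      refine ⟨D ∩ A.1, A.1, h, A.2.1, ⟨?_, ?_, ?_⟩, hCA1, hCA2, hCA3⟩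
      · rw [← e1, Set.inter_comm]; exact Set.inter_subset_inter_right _ hD1
      · rw [← e2, Set.inter_comm]; exact Set.inter_subset_inter_right _ hD2
      · rw [← e3, Set.inter_comm]; exact Set.inter_subset_inter_right _ hD3
    by_cases h12 : C₁.1 = C₂.1
    · by_cases h13 : C₁.1 = C₃.1
      · exact equal h12 h13
      · exact fin (C₁.2.1.subset_of_ne hf C₃.2.1 A.2.1 hCA1 hCA3 h13 hB.isStrong.1
          (hCU1.trans hB1) (hCU3.trans hB3))
    · exact fin (C₁.2.1.subset_of_ne hf C₂.2.1 A.2.1 hCA1 hCA2 h12 hB.isStrong.1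
        (hCU1.trans hB1) (hCU2.trans hB2))
  · rintro ⟨D, A, hD, hA, ⟨hD1, hD2, hD3⟩, hA1, hA2, hA3⟩
    obtain ⟨B, hB, hAB⟩ := hA.exists_succ hm (by omega)
    have hAH : ¬ A ⊆ H := fun h => C₁.2.2 (hA1.trans h)
    -- Taking `y` outside `H` as well makes the new bottom `D + y` proper even when `D` lies in `H`.
    obtain ⟨y, hy, hyA, hyH⟩ := exists_notMem_union hB.isStrong hA.isStrong.1 hH.1
      (hA.not_subset hB (by omega)) (fun h => hAH (hAB.trans h))
    have hyo : ∀ T : Set Q, T ⊆ A → y ∈ 𝔔.orth T := fun T hT x hx =>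
      hB.isStrong.2 x (hAB (hT hx)) y hy
    have key : ∀ C : 𝔔.El H n, D ⊆ C.1 → C.1 ⊆ A → ∃ U : 𝔔.El H (n + 1), C.1 ⊆ U.1 ∧
        U ≠ ⟨A, hA, hAH⟩ ∧ 𝔔.join D y ⊆ U.1 ∧ U.1 ⊆ B := fun C hDC hCA =>
      ⟨⟨𝔔.join C.1 y, C.2.1.join hf (hyo _ hCA) (fun h => hyA (hCA h)),
        fun h => hyH (h (mem_join C.1 y))⟩, subset_join _ _,
        fun h => hyA ((show 𝔔.join C.1 y = A from congrArg Subtype.val h) ▸ mem_join C.1 y),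
        join_subset (isSubspace_join _ _) (hDC.trans (subset_join _ _)) (mem_join _ _),
        join_subset hB.isStrong.1 (hCA.trans hAB) hy⟩
    obtain ⟨U₁, a1, b1, c1, d1⟩ := key C₁ hD1 hA1
    obtain ⟨U₂, a2, b2, c2, d2⟩ := key C₂ hD2 hA2
    obtain ⟨U₃, a3, b3, c3, d3⟩ := key C₃ hD3 hA3
    exact ⟨⟨A, hA, hAH⟩, U₁, U₂, U₃, ⟨𝔔.join D y, B, hD.join hf (hyo _ (hD1.trans hA1))
      (fun h => hyA (hA1 (hD1 h))), hB, fun h => hyH (h (mem_join D y)), ⟨c1, c2, c3⟩, d1, d2, d3⟩,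
      ⟨b1, hA1, a1⟩, ⟨b2, hA2, a2⟩, ⟨b3, hA3, a3⟩⟩

/-- Inside the span `B` of `X` and `Y`, choose `D` of corank one in `C = X ∩ Y` and a point `z` of
`H` outside `C`. The elements `U = D + x + y`, `V = D + x + z`, `W = D + y + z` form the
configuration. An element on both lines would contain `C` and `z`, hence be `C + z`, which lies in
`H`. -/
theorem hasParallel_of_subset (hf : 𝔔.FiniteRank) (hH : 𝔔.IsHyperplane H)
    {X Y : 𝔔.El H (n + 1)} (hXY : Adj (𝔔.affColExt H (n + 1)) X Y) (h : X.1 ∩ Y.1 ⊆ H) :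
    HasParallel (𝔔.affColExt H (n + 1)) X Y := by
  obtain ⟨hne, hC, hp⟩ := (adj_affColExt_iff hf).1 hXY
  have hne' : X.1 ≠ Y.1 := fun h => hne (Subtype.ext h)
  obtain ⟨C, hCdef⟩ : ∃ C, C = X.1 ∩ Y.1 := ⟨_, rfl⟩
  rw [← hCdef] at hC h
  have hCX : C ⊆ X.1 := hCdef ▸ Set.inter_subset_left
  have hCY : C ⊆ Y.1 := hCdef ▸ Set.inter_subset_right
  obtain ⟨B, hB, hXB, hYB⟩ := hC.exists_span hf X.2.1 Y.2.1 hCX hCY hne' hp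
  have hBs := hB.isStrong
  obtain ⟨D, hD, -, hDC⟩ := exists_between hf rk_empty hC (Set.empty_subset _)
    (Nat.zero_le n) (Nat.le_succ n)
  have hXH : X.1 ∩ H = C := hH.inter_eq hf X.2.1 X.2.2 hC hCX h
  have hYH : Y.1 ∩ H = C := hH.inter_eq hf Y.2.1 Y.2.2 hC hCY h
  obtain ⟨x, hx, hxH⟩ := Set.not_subset.1 X.2.2
  obtain ⟨y, hy, hyH⟩ := Set.not_subset.1 Y.2.2
  have hxC : x ∉ C := fun h' => hxH (h h')
  have hyC : y ∉ C := fun h' => hyH (h h')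
  have hyX : y ∉ X.1 := fun h' => hyC (hCdef ▸ ⟨h', hy⟩)
  have hxY : x ∉ Y.1 := fun h' => hxC (hCdef ▸ ⟨hx, h'⟩)
  have hxy : x ≠ y := fun h' => hxY (h' ▸ hy)
  have hxB := hXB hx
  have hyB := hYB hy
  have hDB : D ⊆ B := hDC.trans (hCX.trans hXB)
  have ort : ∀ T ⊆ B, ∀ z ∈ B, z ∈ 𝔔.orth T := fun T hT z hz t ht => hBs.2 t (hT ht) z hz
  -- the point of the line `x y` in `H`
  obtain ⟨L, hL, hxL, hyL⟩ := (hBs.2 x hxB y hyB).resolve_left hxy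
  obtain ⟨g, hgL, hgH⟩ := hH.2.2 L hL
  have hg : 𝔔.Col x y g := ⟨L, hL, hxL, hyL, hgL⟩
  have hgB := hBs.1.col hxB hyB hxy hg
  have hgx : x ≠ g := by rintro rfl; exact hxH hgH
  have hgC : g ∉ C := fun h' => hyX (X.2.1.isStrong.1.col hx (hCX h') hgx hg.swap')
  -- `z` is a third point of the line joining `c` and `g`, both in `H`. Since `U` contains `g` but
  -- not `c`, it misses `z`.
  obtain ⟨c, hc, hcD⟩ := Set.not_subset.1 (hD.not_subset hC (Nat.lt_succ_self n))
  have hcB := hXB (hCX hc)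
  have hcg : c ≠ g := by rintro rfl; exact hgC hc
  obtain ⟨z, hz, hzc, hzg⟩ := exists_third (hBs.2 c hcB g hgB) hcg
  have hzH := hH.1.col (h hc) hgH hcg hz
  have hzB := hBs.1.col hcB hgB hcg hz
  have hzC : z ∉ C := fun h' => hgC (hC.isStrong.1.col hc h' hzc.symm hz.swap')
  have hzX : z ∉ X.1 := fun h' => hzC (hXH ▸ ⟨h', hzH⟩)
  have hzY : z ∉ Y.1 := fun h' => hzC (hYH ▸ ⟨h', hzH⟩)
  -- the corank one subspaces `D + x`, `D + y`, `D + z`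
  have hDx := hD.join hf (ort D hDB x hxB) (fun h' => hxC (hDC h'))
  have hDy := hD.join hf (ort D hDB y hyB) (fun h' => hyC (hDC h'))
  have hDz := hD.join hf (ort D hDB z hzB) (fun h' => hzC (hDC h'))
  have hDxX : 𝔔.join D x ⊆ X.1 := join_subset X.2.1.isStrong.1 (hDC.trans hCX) hx
  have hDyY : 𝔔.join D y ⊆ Y.1 := join_subset Y.2.1.isStrong.1 (hDC.trans hCY) hy
  have hDxB := hDxX.trans hXB
  have hDyB := hDyY.trans hYB
  have hU := hDx.join hf (ort _ hDxB y hyB) (fun h' => hyX (hDxX h'))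
  have hV := hDx.join hf (ort _ hDxB z hzB) (fun h' => hzX (hDxX h'))
  have hW := hDy.join hf (ort _ hDyB z hzB) (fun h' => hzY (hDyY h'))
  have hUB := join_subset hBs.1 hDxB hyB
  have hVB := join_subset hBs.1 hDxB hzB
  have hWB := join_subset hBs.1 hDyB hzB
  have hxU : x ∈ 𝔔.join (𝔔.join D x) y := subset_join _ _ (mem_join D x)
  have hyU : y ∈ 𝔔.join (𝔔.join D x) y := mem_join _ _
  have hxV : x ∈ 𝔔.join (𝔔.join D x) z := subset_join _ _ (mem_join D x)
  have hyW : y ∈ 𝔔.join (𝔔.join D y) z := subset_join _ _ (mem_join D y)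
  have hzV : z ∈ 𝔔.join (𝔔.join D x) z := mem_join _ _
  have hzW : z ∈ 𝔔.join (𝔔.join D y) z := mem_join _ _
  have hDyU : 𝔔.join D y ⊆ 𝔔.join (𝔔.join D x) y := join_subset (isSubspace_join _ _)
    ((subset_join D x).trans (subset_join _ _)) hyU
  have hcU : c ∉ 𝔔.join (𝔔.join D x) y := fun h' => by
    have h1 : C ⊆ 𝔔.join (𝔔.join D x) y := hD.subset_of_mem hf hC hDC (isSubspace_join _ _)
      ((subset_join D x).trans (subset_join _ _)) hc hcD h'
    have h2 := hC.subset_of_mem hf X.2.1 hCX (isSubspace_join _ _) h1 hx hxC hxU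
    have h3 := hC.subset_of_mem hf Y.2.1 hCY (isSubspace_join _ _) h1 hy hyC hyU
    exact hne' ((X.2.1.eq_of_subset hU h2).trans (Y.2.1.eq_of_subset hU h3).symm)
  have hgU := (isSubspace_join (𝔔 := 𝔔) (𝔔.join D x) y).col hxU hyU hxy hg
  have hzU : z ∉ 𝔔.join (𝔔.join D x) y := fun h' =>
    hcU ((isSubspace_join (𝔔 := 𝔔) _ _).col hgU h' hzg.symm hz.rot)
  have hVW : 𝔔.join (𝔔.join D x) z ≠ 𝔔.join (𝔔.join D y) z := fun h' => by
    have h1 := hDx.subset_of_mem hf hU (subset_join _ _) (isSubspace_join (𝔔.join D x) z)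
      (subset_join _ _) hyU (fun h => hyX (hDxX h)) (h' ▸ hyW)
    exact hzU (hU.eq_of_subset hV h1 ▸ hzV)
  let U : 𝔔.El H (n + 1) := ⟨_, hU, fun h => hxH (h hxU)⟩
  let V : 𝔔.El H (n + 1) := ⟨_, hV, fun h => hxH (h hxV)⟩
  let W : 𝔔.El H (n + 1) := ⟨_, hW, fun h => hyH (h hyW)⟩
  have ne : ∀ {P P' : 𝔔.El H (n + 1)} (t : Q), t ∈ P.1 → t ∉ P'.1 → P ≠ P' := by
    rintro P P' t h1 h2 rfl; exact h2 h1
  refine ⟨U, V, W, fun hc' => ?_, ne z hzV hzU, ne z hzV hzX, ne z hzW hzU, ne z hzW hzY,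
    ⟨𝔔.join D x, B, hDx, hB, ⟨subset_join _ _, hDxX, subset_join _ _⟩, hUB, hXB, hVB⟩,
    ⟨𝔔.join D y, B, hDy, hB, ⟨hDyU, hDyY, subset_join _ _⟩, hUB, hYB, hWB⟩,
    ⟨fun h => hVW (congrArg Subtype.val h), 𝔔.join D z, B, hDz, hB, ⟨?_, ?_, ?_⟩, hVB, hWB, hWB⟩,
    ?_⟩
  · exact hcU ((hc'.base hf hne).2.1 (hCdef ▸ hc))
  · exact join_subset (isSubspace_join _ _) ((subset_join D x).trans (subset_join _ _)) hzV
  · exact join_subset (isSubspace_join _ _) ((subset_join D y).trans (subset_join _ _)) hzW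
  · exact join_subset (isSubspace_join _ _) ((subset_join D y).trans (subset_join _ _)) hzW
  · rintro ⟨P, h1, h2⟩
    have h3 : C ⊆ P.1 := hCdef ▸ (h1.base hf hne).2.1
    have h4 : z ∈ P.1 := (h2.base hf (fun h => hVW (congrArg Subtype.val h))).2.1 ⟨hzV, hzW⟩
    have hCz := hC.join hf (ort C (hCX.trans hXB) z hzB) hzC
    have h5 := hCz.eq_of_subset P.2.1 (join_subset P.2.1.isStrong.1 h3 h4)
    exact P.2.2 (h5 ▸ join_subset hH.1 h hzH)

/-- With the bottom `C` outside `H` the Veblen axiom holds: the meeting element can be taken to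
contain `C`, so it is never lost in `H`. -/
theorem _root_.HasParallel.subset (hf : 𝔔.FiniteRank)
    {X Y : 𝔔.El H (n + 1)} (hXY : Adj (𝔔.affColExt H (n + 1)) X Y)
    (h : HasParallel (𝔔.affColExt H (n + 1)) X Y) : X.1 ∩ Y.1 ⊆ H := by
  by_contra hCH
  obtain ⟨hne, hC, hp⟩ := (adj_affColExt_iff hf).1 hXY
  have hne' : X.1 ≠ Y.1 := fun h => hne (Subtype.ext h)
  obtain ⟨U, V, W, hU, hVU, hVX, hWU, hWY, h1, h2, hVW, hno⟩ := h
  obtain ⟨C, hCdef⟩ : ∃ C, C = X.1 ∩ Y.1 := ⟨_, rfl⟩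
  rw [← hCdef] at hC hCH
  have hCX : C ⊆ X.1 := hCdef ▸ Set.inter_subset_left
  have hCY : C ⊆ Y.1 := hCdef ▸ Set.inter_subset_right
  obtain ⟨B, hB, hXB, hYB⟩ := hC.exists_span hf X.2.1 Y.2.1 hCX hCY hne' hp
  have hBs := hB.isStrong
  have hUne : ∀ Z : 𝔔.El H (n + 1), Z = X ∨ Z = Y → U ≠ Z := by
    rintro Z (rfl | rfl) rfl
    · exact hU ⟨C, B, hC, hB, ⟨hCX, hCY, hCX⟩, hXB, hYB, hXB⟩
    · exact hU ⟨C, B, hC, hB, ⟨hCX, hCY, hCY⟩, hXB, hYB, hYB⟩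
  have hUX := hUne X (Or.inl rfl)
  have hUY := hUne Y (Or.inr rfl)
  obtain ⟨hC1, hC1V, hp1⟩ := h1.base hf hUX
  obtain ⟨hC2, hC2W, hp2⟩ := h2.base hf hUY
  obtain ⟨hVWne, hC', hpVW⟩ := (adj_affColExt_iff hf).1 hVW
  have hVWne' : V.1 ≠ W.1 := fun h => hVWne (Subtype.ext h)
  obtain ⟨B', hB', hVB', hWB'⟩ := hC'.exists_span hf V.2.1 W.2.1 Set.inter_subset_left
    Set.inter_subset_right hVWne' hpVW
  -- If `U` meets `X` and `Y` in the same subspace, the configuration is a plane in the residue of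
  -- `C`, and the tops `B` and `B'` meet in the required element. Otherwise everything lies in `B`,
  -- and the element is spanned by `C` and a point of `V ∩ W`. When the tops, respectively the
  -- bottoms, coincide, `X` itself serves.
  by_cases hstar : U.1 ∩ X.1 = U.1 ∩ Y.1
  · have hUC : U.1 ∩ X.1 = C := hC1.eq_of_subset hC (hCdef ▸ Set.subset_inter
      Set.inter_subset_right (hstar ▸ Set.inter_subset_right))
    have hCU : C ⊆ U.1 := hUC ▸ Set.inter_subset_left
    have hCV : C ⊆ V.1 := hUC ▸ hC1V
    have hCW : C ⊆ W.1 := hUC ▸ hstar ▸ hC2W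
    have hUB : ¬ U.1 ⊆ B := fun h' => hU ⟨C, B, hC, hB, ⟨hCX, hCY, hCU⟩, hXB, hYB, h'⟩
    obtain ⟨u, hu, huB⟩ := Set.not_subset.1 hUB
    have hBU : 𝔔.PerpSets B U.1 := X.2.1.perpSets_of_ne hf Y.2.1 hB hXB hYB hne' hp1.symm hp2.symm
    have hM := hB.join hf (a := u) (fun b hb => hBU b hb u hu) huB
    have hMs := hM.isStrong.1
    have hXM := hXB.trans (subset_join (𝔔 := 𝔔) B u)
    have hYM := hYB.trans (subset_join (𝔔 := 𝔔) B u)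
    have hUM : U.1 ⊆ 𝔔.join B u := hC.subset_of_mem hf U.2.1 hCU hMs
      (hCX.trans hXM) hu (fun h' => huB (hXB (hCX h'))) (mem_join B u)
    have hVM := h1.subset hf hUX hMs hUM hXM
    have hWM := h2.subset hf hUY hMs hUM hYM
    have hB'M := V.2.1.subset_of_ne hf W.2.1 hB' hVB' hWB' hVWne' hMs hVM hWM
    by_cases hBB : B = B'
    · exact hno ⟨X, ⟨C, B, hC, hB, ⟨hCX, hCY, hCX⟩, hXB, hYB, hXB⟩,
        C, B, hC, hB, ⟨hCV, hCW, hCX⟩, hBB ▸ hVB', hBB ▸ hWB', hXB⟩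
    · have hP := hB.inter_of_ne hf hB' hM (subset_join _ _) hB'M hBB
      have hCP : C ⊆ B ∩ B' := Set.subset_inter (hCX.trans hXB) (hCV.trans hVB')
      exact hno ⟨⟨_, hP, fun h => hCH (hCP.trans h)⟩,
        ⟨C, B, hC, hB, ⟨hCX, hCY, hCP⟩, hXB, hYB, Set.inter_subset_left⟩,
        C, B', hC, hB', ⟨hCV, hCW, hCP⟩, hVB', hWB', Set.inter_subset_right⟩
  · have hUB : U.1 ⊆ B := hC1.subset_of_ne hf hC2 U.2.1 Set.inter_subset_left
      Set.inter_subset_left hstar hBs.1 (Set.inter_subset_right.trans hXB)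
      (Set.inter_subset_right.trans hYB)
    have hVB := h1.subset hf hUX hBs.1 hUB hXB
    have hWB := h2.subset hf hUY hBs.1 hUB hYB
    have hD := hC1.inter_of_ne hf hC2 U.2.1 Set.inter_subset_left Set.inter_subset_left hstar
    obtain ⟨D, hDdef⟩ : ∃ D, D = U.1 ∩ X.1 ∩ (U.1 ∩ Y.1) := ⟨_, rfl⟩
    rw [← hDdef] at hD
    have hDC : D ⊆ C := hDdef ▸ hCdef ▸ fun t ht => ⟨ht.1.2, ht.2.2⟩
    have hDC' : D ⊆ V.1 ∩ W.1 := hDdef ▸ fun t ht => ⟨hC1V ht.1, hC2W ht.2⟩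
    by_cases hsub : V.1 ∩ W.1 ⊆ C
    · have hCC' := hC'.eq_of_subset hC hsub
      exact hno ⟨X, ⟨C, B, hC, hB, ⟨hCX, hCY, hCX⟩, hXB, hYB, hXB⟩, C, B, hC, hB,
        ⟨hCC' ▸ Set.inter_subset_left, hCC' ▸ Set.inter_subset_right, hCX⟩, hVB, hWB, hXB⟩
    · obtain ⟨c, hc, hcC⟩ := Set.not_subset.1 hsub
      have hcB := hVB hc.1
      have hP := hC.join hf (a := c) (fun t ht => hBs.2 t (hXB (hCX ht)) c hcB) hcC
      have hPB : 𝔔.join C c ⊆ B := join_subset hBs.1 (hCX.trans hXB) hcB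
      have hC'P : V.1 ∩ W.1 ⊆ 𝔔.join C c := hD.subset_of_mem hf hC' hDC' (isSubspace_join _ _)
        (hDC.trans (subset_join _ _)) hc (fun h => hcC (hDC h)) (mem_join _ _)
      exact hno ⟨⟨_, hP, fun h => hCH ((subset_join C c).trans h)⟩,
        ⟨C, B, hC, hB, ⟨hCX, hCY, subset_join _ _⟩, hXB, hYB, hPB⟩,
        _, B, hC', hB, ⟨Set.inter_subset_left, Set.inter_subset_right, hC'P⟩, hVB, hWB, hPB⟩

theorem exists_corank_one (hf : 𝔔.FiniteRank) {A : Set Q} (hA : 𝔔.Rk A (n + 2)) {a : Q}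
    (ha : a ∈ A) : ∃ C, 𝔔.Rk C (n + 1) ∧ a ∈ C ∧ C ⊆ A := by
  obtain ⟨C, hC, h1, h2⟩ := exists_between hf (rk_singleton hf a) hA
    (Set.singleton_subset_iff.2 ha) (by omega : 1 ≤ n + 1) (Nat.le_succ _)
  exact ⟨C, hC, h1 rfl, h2⟩

theorem properCol_iff (hf : 𝔔.FiniteRank) (hH : 𝔔.IsHyperplane H)
    {X Y Z : 𝔔.El H (n + 1)} :
    ProperCol (𝔔.affColExt H (n + 1)) X Y Z ↔ 𝔔.affCol H (n + 1) X Y Z := by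
  constructor
  · rintro ⟨⟨C, B, hC, hB, ⟨h1, h2, h3⟩, h4, h5, h6⟩, hXY, hXZ, hYZ⟩
    have key : ∀ P P' : 𝔔.El H (n + 1), C ⊆ P.1 → C ⊆ P'.1 → P.1 ⊆ B → P'.1 ⊆ B → P ≠ P' →
        (P ≠ P' → ¬ HasParallel (𝔔.affColExt H (n + 1)) P P') → ¬ C ⊆ H := by
      intro P P' hP hP' hPB hPB' hne hpar hCH
      have e := hC.inter_eq hf P.2.1 P'.2.1 hP hP' (fun h => hne (Subtype.ext h))
      exact hpar hne (hasParallel_of_subset hf hH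
        ⟨hne, C, B, hC, hB, ⟨hP, hP', hP'⟩, hPB, hPB', hPB'⟩ (e ▸ hCH))
    by_cases e1 : X = Y
    · by_cases e2 : X = Z
      -- A repeated triple says nothing about the given bottom, which may lie in `H`; any bottom
      -- through a point of `X` outside `H` replaces it.
      · subst e1 e2
        obtain ⟨x, hx, hxH⟩ := Set.not_subset.1 X.2.2
        obtain ⟨C, hC, hxC, hCX⟩ := exists_corank_one hf X.2.1 hx
        exact ⟨C, B, hC, hB, fun h => hxH (h hxC), ⟨hCX, hCX, hCX⟩, h4, h4, h4⟩
      · exact ⟨C, B, hC, hB, key X Z h1 h3 h4 h6 e2 hXZ, ⟨h1, h2, h3⟩, h4, h5, h6⟩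
    · exact ⟨C, B, hC, hB, key X Y h1 h2 h4 h5 e1 hXY, ⟨h1, h2, h3⟩, h4, h5, h6⟩
  · rintro ⟨C, B, hC, hB, hCH, ⟨h1, h2, h3⟩, h4, h5, h6⟩
    have key : ∀ P P' : 𝔔.El H (n + 1), C ⊆ P.1 → C ⊆ P'.1 → P.1 ⊆ B → P'.1 ⊆ B → P ≠ P' →
        ¬ HasParallel (𝔔.affColExt H (n + 1)) P P' := by
      intro P P' hP hP' hPB hPB' hne hpar
      have e := hC.inter_eq hf P.2.1 P'.2.1 hP hP' (fun h => hne (Subtype.ext h))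
      exact hCH (e ▸ hpar.subset hf
        ⟨hne, C, B, hC, hB, ⟨hP, hP', hP'⟩, hPB, hPB', hPB'⟩)
    exact ⟨⟨C, B, hC, hB, ⟨h1, h2, h3⟩, h4, h5, h6⟩, key X Y h1 h2 h4 h5, key X Z h1 h3 h4 h6,
      key Y Z h2 h3 h5 h6⟩

end PolarSpace

/-! ### Predicates uniformly definable by first-order formulas -/

/-- A ternary relation as a first-order structure. -/
abbrev relStructure {S : Type*} (R : S → S → S → Prop) : collinearityLang.Structure S where
  funMap := fun f => f.elim
  RelMap := fun {_} r => match r with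
    | .col => fun x => R (x 0) (x 1) (x 2)

/-- Truth of a formula in the structure given by a ternary relation. -/
def Holds {S : Type*} (R : S → S → S → Prop) {α : Type*} (φ : collinearityLang.Formula α)
    (v : α → S) : Prop :=
  @FirstOrder.Language.Formula.Realize collinearityLang S (relStructure R) α φ v

universe u

/-- A predicate of ternary relations and valuations given by a first-order formula. -/
def FODef (α : Type) (P : ∀ S : Type u, (S → S → S → Prop) → (α → S) → Prop) : Prop :=
  ∃ φ : collinearityLang.Formula α, ∀ (S : Type u) (R : S → S → S → Prop) (v : α → S),
    Holds R φ v ↔ P S R v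

namespace FODef

open FirstOrder Language

variable {α β : Type} {P P' : ∀ S : Type u, (S → S → S → Prop) → (α → S) → Prop}

theorem top : FODef.{u} α fun _ _ _ => True := ⟨⊤, fun S R v => by
  let := relStructure R
  exact Formula.realize_top⟩

theorem bot : FODef.{u} α fun _ _ _ => False := ⟨⊥, fun _ _ _ => Iff.rfl⟩

theorem eq (i j : α) : FODef.{u} α fun _ _ v => v i = v j :=
  ⟨Term.equal (Term.var i) (Term.var j), fun S R v => by
    let := relStructure R
    exact Formula.realize_equal⟩

theorem rel (i j k : α) : FODef.{u} α fun _ R v => R (v i) (v j) (v k) :=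
  ⟨Relations.formula (L := collinearityLang) CollinearityRel.col
      ![Term.var i, Term.var j, Term.var k], fun S R v => by
    let := relStructure R
    exact Formula.realize_rel⟩

theorem imp (h : FODef α P) (h' : FODef α P') : FODef α fun S R v => P S R v → P' S R v := by
  obtain ⟨φ, hφ⟩ := h
  obtain ⟨ψ, hψ⟩ := h'
  refine ⟨φ.imp ψ, fun S R v => ?_⟩
  beta_reduce
  rw [← hφ, ← hψ]
  let := relStructure R
  exact Formula.realize_imp

theorem not (h : FODef α P) : FODef α fun S R v => ¬ P S R v := h.imp bot

theorem and (h : FODef α P) (h' : FODef α P') : FODef α fun S R v => P S R v ∧ P' S R v := by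
  obtain ⟨φ, hφ⟩ := h
  obtain ⟨ψ, hψ⟩ := h'
  refine ⟨φ ⊓ ψ, fun S R v => ?_⟩
  beta_reduce
  rw [← hφ, ← hψ]
  let := relStructure R
  exact Formula.realize_inf

theorem or (h : FODef α P) (h' : FODef α P') : FODef α fun S R v => P S R v ∨ P' S R v := by
  obtain ⟨φ, hφ⟩ := h
  obtain ⟨ψ, hψ⟩ := h'
  refine ⟨φ ⊔ ψ, fun S R v => ?_⟩
  beta_reduce
  rw [← hφ, ← hψ]
  let := relStructure R
  exact Formula.realize_sup

theorem comp (h : FODef α P) (g : α → β) : FODef β fun S R v => P S R (v ∘ g) := by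
  obtain ⟨φ, hφ⟩ := h
  refine ⟨φ.relabel g, fun S R v => ?_⟩
  beta_reduce
  rw [← hφ]
  let := relStructure R
  exact Formula.realize_relabel

theorem ex {P : ∀ S : Type u, (S → S → S → Prop) → (α → S) → S → Prop}
    (h : FODef (α ⊕ Unit) fun S R v => P S R (fun a => v (Sum.inl a)) (v (Sum.inr ()))) :
    FODef α fun S R v => ∃ x, P S R v x := by
  obtain ⟨φ, hφ⟩ := h
  refine ⟨φ.iExs Unit, fun S R v => ?_⟩
  have h1 : Holds R (φ.iExs Unit) v ↔ ∃ i : Unit → S, Holds R φ (Sum.elim v i) := by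
    let := relStructure R
    exact Formula.realize_iExs
  rw [h1]
  simp only [hφ, Sum.elim_inl, Sum.elim_inr]
  exact ⟨fun ⟨i, h⟩ => ⟨i (), h⟩, fun ⟨x, h⟩ => ⟨fun _ => x, h⟩⟩

theorem all {P : ∀ S : Type u, (S → S → S → Prop) → (α → S) → S → Prop}
    (h : FODef (α ⊕ Unit) fun S R v => P S R (fun a => v (Sum.inl a)) (v (Sum.inr ()))) :
    FODef α fun S R v => ∀ x, P S R v x := by
  obtain ⟨φ, hφ⟩ := (FODef.ex (P := fun S R v x => ¬ P S R v x) h.not).not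
  exact ⟨φ, fun S R v => by rw [hφ]; push Not; rfl⟩

theorem forall_finite {ι : Type} [Finite ι]
    {P : ι → ∀ S : Type u, (S → S → S → Prop) → (α → S) → Prop} (h : ∀ i, FODef α (P i)) :
    FODef α fun S R v => ∀ i, P i S R v := by
  choose φ hφ using h
  refine ⟨BoundedFormula.iInf φ, fun S R v => ?_⟩
  have h1 : Holds R (BoundedFormula.iInf φ) v ↔ ∀ i, Holds R (φ i) v := by
    let := relStructure R
    exact BoundedFormula.realize_iInf
  rw [h1]
  exact forall_congr' fun i => hφ i S R v

variable {T : ∀ S : Type u, (S → S → S → Prop) → S → S → S → Prop}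
  (hT : FODef (Fin 3) fun S R v => T S R (v 0) (v 1) (v 2))

include hT

theorem ternary (i j k : α) : FODef α fun S R v => T S R (v i) (v j) (v k) := hT.comp ![i, j, k]

theorem adj (i j : α) : FODef α fun S R v => Adj (T S R) (v i) (v j) :=
  (eq i j).not.and (hT.ternary i j j)

theorem commonNbr (i j k : α) : FODef α fun S R v => CommonNbr (T S R) (v i) (v j) (v k) :=
  (hT.adj k i).and (hT.adj k j)

theorem par (i j : α) : FODef α fun S R v => Par (T S R) (v i) (v j) := by
  refine (eq i j).not.and ((hT.adj i j).not.and (ex (ex ?_)))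
  exact (eq _ _).not.and ((hT.commonNbr _ _ _).and ((hT.commonNbr _ _ _).and (hT.ternary _ _ _)))

theorem share (i j : α) : FODef α fun S R v => Share (T S R) (v i) (v j) := by
  refine (eq i j).not.and ((hT.adj i j).not.and ((ex (ex ?_)).and (ex (ex (ex ?_))).not))
  · exact (eq _ _).not.and ((hT.commonNbr _ _ _).and (hT.commonNbr _ _ _))
  · exact (eq _ _).not.and ((hT.commonNbr _ _ _).and ((hT.commonNbr _ _ _).and
      ((hT.par _ _).and ((hT.adj _ _).and (hT.adj _ _)))))

theorem contains (i j k : α) : FODef α fun S R v => Contains (T S R) (v i) (v j) (v k) := by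
  refine ex (ex ?_)
  exact (hT.commonNbr _ _ _).and ((hT.ternary _ _ _).and ((eq _ _).or
    ((hT.share _ _).and (hT.commonNbr _ _ _))))

theorem stepCol (i₁ j₁ i₂ j₂ i₃ j₃ : α) : FODef α fun S R v =>
    StepCol (T S R) (v i₁) (v j₁) (v i₂) (v j₂) (v i₃) (v j₃) := by
  refine ex (ex (ex (ex ?_)))
  exact (hT.ternary _ _ _).and
    (((eq _ _).not.and ((hT.contains _ _ _).and (hT.contains _ _ _))).and
    (((eq _ _).not.and ((hT.contains _ _ _).and (hT.contains _ _ _))).and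
    ((eq _ _).not.and ((hT.contains _ _ _).and (hT.contains _ _ _)))))

omit hT in
theorem hasParallel (i j : α) : FODef.{u} α fun _ R v => HasParallel R (v i) (v j) := by
  have hT : FODef.{u} (Fin 3) fun S R v => (fun _ R => R : ∀ S : Type u, (S → S → S → Prop) →
    S → S → S → Prop) S R (v 0) (v 1) (v 2) := rel 0 1 2
  refine ex (ex (ex ?_))
  exact (rel _ _ _).not.and ((eq _ _).not.and ((eq _ _).not.and ((eq _ _).not.and
    ((eq _ _).not.and ((rel _ _ _).and ((rel _ _ _).and ((hT.adj _ _).and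
    (ex ((rel _ _ _).and (rel _ _ _))).not)))))))

omit hT in
theorem properCol (i j k : α) : FODef.{u} α fun _ R v => ProperCol R (v i) (v j) (v k) :=
  (rel i j k).and (((eq i j).not.imp (hasParallel i j).not).and
    (((eq i k).not.imp (hasParallel i k).not).and ((eq j k).not.imp (hasParallel j k).not)))

end FODef

/-! ### Interpretation by pairs: translating formulas and composing definitions -/

/-- The relation `R'` on `S'`, and the relation `mem` between `S'` and `S`, are given by formulas
over `R`, the elements of `S'` being coded by the pairs of elements of `S` related by `Share`. -/
structure IsPairCoding {S S' : Type u} (R : S → S → S → Prop) (R' : S' → S' → S' → Prop)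
    (mem : S' → S → Prop) (e : {p : S × S // Share R p.1 p.2} → S') : Prop where
  surjective : Function.Surjective e
  eq_iff : ∀ p q, e p = e q ↔ Contains R p.1.1 p.1.2 q.1.1 ∧ Contains R p.1.1 p.1.2 q.1.2
  rel_iff : ∀ p q r, R' (e p) (e q) (e r) ↔
    StepCol R p.1.1 p.1.2 q.1.1 q.1.2 r.1.1 r.1.2
  mem_iff : ∀ p a, mem (e p) a ↔ Contains R p.1.1 p.1.2 a

/-- The valuation of the components of pairs. -/
def unpair {α S : Type*} {p : S × S → Prop} (w : α → {q : S × S // p q}) (i : α × Bool) : S :=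
  cond i.2 (w i.1).1.2 (w i.1).1.1

theorem collinearityLang_term {γ : Type} (t : collinearityLang.Term γ) :
    ∃ i, t = FirstOrder.Language.Term.var i := by
  cases t with
  | var i => exact ⟨i, rfl⟩
  | func f _ => exact f.elim

open FirstOrder Language in
/-- Formulas over coded elements translate to formulas over the codes. -/
theorem exists_translation_bounded
    {T : ∀ S : Type u, (S → S → S → Prop) → S → S → S → Prop}
    (hT : FODef (Fin 3) fun S R v => T S R (v 0) (v 1) (v 2)) {α : Type} {n : ℕ}
    (φ : collinearityLang.BoundedFormula α n) :
    ∃ P : ∀ S : Type u, (S → S → S → Prop) → ((α ⊕ Fin n) × Bool → S) → Prop,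
      FODef _ P ∧ ∀ (S S' : Type u) (R : S → S → S → Prop) (R' : S' → S' → S' → Prop)
        (mem : S' → S → Prop) (e : _ → S'), IsPairCoding (T S R) R' mem e →
        ∀ w : α ⊕ Fin n → _, @BoundedFormula.Realize collinearityLang S' (relStructure R') α n φ
          (fun i => e (w (Sum.inl i))) (fun i => e (w (Sum.inr i))) ↔ P S R (unpair w) := by
  have elim_eq : ∀ {n : ℕ} {S S' : Type u} (e : S → S') (w : α ⊕ Fin n → S),
      Sum.elim (fun i => e (w (Sum.inl i))) (fun i => e (w (Sum.inr i))) = fun i => e (w i) := by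
    intro n S S' e w
    funext i
    cases i <;> rfl
  induction φ with
  | falsum => exact ⟨_, FODef.bot, fun _ _ _ _ _ _ _ _ => Iff.rfl⟩
  | equal t₁ t₂ =>
    obtain ⟨i, rfl⟩ := collinearityLang_term t₁
    obtain ⟨j, rfl⟩ := collinearityLang_term t₂
    refine ⟨_, (hT.contains (i, false) (i, true) (j, false)).and
      (hT.contains (i, false) (i, true) (j, true)), fun S S' R R' mem e h w => ?_⟩
    let := relStructure R'
    rw [BoundedFormula.Realize, elim_eq e w]
    exact h.eq_iff (w i) (w j)
  | rel r ts =>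
    cases r
    choose i hi using fun k => collinearityLang_term (ts k)
    refine ⟨_, hT.stepCol (i 0, false) (i 0, true) (i 1, false) (i 1, true) (i 2, false)
      (i 2, true), fun S S' R R' mem e h w => ?_⟩
    let := relStructure R'
    rw [BoundedFormula.Realize, elim_eq e w]
    simp only [hi]
    exact h.rel_iff (w (i 0)) (w (i 1)) (w (i 2))
  | imp φ ψ ih₁ ih₂ =>
    obtain ⟨P₁, hP₁, h₁⟩ := ih₁
    obtain ⟨P₂, hP₂, h₂⟩ := ih₂
    refine ⟨_, hP₁.imp hP₂, fun S S' R R' mem e h w => ?_⟩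
    let := relStructure R'
    rw [BoundedFormula.Realize, h₁ S S' R R' mem e h, h₂ S S' R R' mem e h]
  | @all n φ ih =>
    obtain ⟨P, hP, h⟩ := ih
    -- A quantifier over coded elements becomes two quantifiers relativised to `Share`; `g` sends
    -- the two components of the last bound variable to the two new variables and keeps the rest.
    let g : (α ⊕ Fin (n + 1)) × Bool → (((α ⊕ Fin n) × Bool) ⊕ Unit) ⊕ Unit := fun i =>
      Sum.elim (fun a => Sum.inl (Sum.inl (Sum.inl a, i.2)))
        (Fin.lastCases (cond i.2 (Sum.inr ()) (Sum.inl (Sum.inr ())))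
          (fun j => Sum.inl (Sum.inl (Sum.inr j, i.2)))) i.1
    let ext : ∀ S : Type u, ((α ⊕ Fin n) × Bool → S) → S → S → (α ⊕ Fin (n + 1)) × Bool → S :=
      fun S v x y => Sum.elim (Sum.elim v fun _ => x) (fun _ => y) ∘ g
    refine ⟨fun S R v => ∀ x y, Share (T S R) x y → P S R (ext S v x y),
      FODef.all (FODef.all ((hT.share _ _).imp ?_)), fun S S' R R' mem e hc w => ?_⟩
    · convert hP.comp g using 4
      refine Iff.of_eq (congrArg _ (funext fun i => ?_))
      simp only [ext, Function.comp]
      generalize g i = z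
      rcases z with (z | z) | z <;> rfl
    · let := relStructure R'
      rw [BoundedFormula.Realize]
      rw [hc.surjective.forall]
      have key : ∀ q, @BoundedFormula.Realize collinearityLang S' (relStructure R') α (n + 1) φ
          (fun i => e (w (Sum.inl i))) (Fin.snoc (fun i => e (w (Sum.inr i))) (e q)) ↔
          P S R (ext S (unpair w) q.1.1 q.1.2) := by
        intro q
        have := h S S' R R' mem e hc (Sum.elim (fun a => w (Sum.inl a))
          (Fin.snoc (α := fun _ => _) (fun j => w (Sum.inr j)) q))
        convert this using 2
        · rfl
        · funext i
          refine Fin.lastCases ?_ (fun j => ?_) i <;> simp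
        · funext ⟨i, b⟩
          rcases i with a | i
          · rfl
          · refine Fin.lastCases ?_ (fun j => ?_) i
            · cases b <;> simp [ext, g, unpair]
            · cases b <;> simp [ext, g, unpair]
      simp only [key]
      exact ⟨fun h x y hxy => h ⟨(x, y), hxy⟩, fun h q => h _ _ q.2⟩

open FirstOrder Language in
theorem exists_translation
    {T : ∀ S : Type u, (S → S → S → Prop) → S → S → S → Prop}
    (hT : FODef (Fin 3) fun S R v => T S R (v 0) (v 1) (v 2)) {α : Type}
    (φ : collinearityLang.Formula α) :
    ∃ P : ∀ S : Type u, (S → S → S → Prop) → (α × Bool → S) → Prop,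
      FODef _ P ∧ ∀ (S S' : Type u) (R : S → S → S → Prop) (R' : S' → S' → S' → Prop)
        (mem : S' → S → Prop) (e : _ → S'), IsPairCoding (T S R) R' mem e →
        ∀ w : α → _, Holds R' φ (fun i => e (w i)) ↔ P S R (unpair w) := by
  obtain ⟨P, hP, h⟩ := exists_translation_bounded hT φ
  refine ⟨_, hP.comp fun i => (Sum.elim id Fin.elim0 i.1, i.2), fun S S' R R' mem e hc w => ?_⟩
  have := h S S' R R' mem e hc (fun i => w (Sum.elim id Fin.elim0 i))
  refine Iff.trans (Iff.of_eq ?_) this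
  unfold Holds Formula.Realize
  congr 1
  funext i
  exact i.elim0

/-- `DefinitionScheme.Defines` for the structure of a ternary relation. -/
def DefinitionScheme.DefinesRel (σ : DefinitionScheme) {P S : Type*} (𝓖 : Set (Set P))
    (R : S → S → S → Prop) (inc : P → S → Prop) : Prop :=
  ∃ (f : {x : Fin σ.n → S // Holds R σ.isPoint x} → P)
    (g : {y : Fin σ.r → S // Holds R σ.isLine y} → 𝓖),
    Function.Surjective f ∧ Function.Surjective g ∧
    (∀ x x', f x = f x' ↔ Holds R σ.samePoint (Sum.elim x.1 x'.1)) ∧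
    (∀ x y, f x ∈ (g y).1 ↔ Holds R σ.onLine (Sum.elim x.1 y.1)) ∧
    (∀ x A, inc (f x) A ↔ Holds R σ.onElement (Sum.elim x.1 (fun _ : Fin 1 => A)))

theorem DefinitionScheme.defines_iff (σ : DefinitionScheme) {P S : Type*} (𝓖 : Set (Set P))
    (𝓛 : Set (Set S)) (inc : P → S → Prop) :
    σ.Defines 𝓖 𝓛 inc ↔ σ.DefinesRel 𝓖 (fun a b c => ∃ l ∈ 𝓛, a ∈ l ∧ b ∈ l ∧ c ∈ l) inc :=
  Iff.rfl

/-- A definition over coded elements yields a definition over the codes. -/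
theorem DefinitionScheme.exists_comp
    {T : ∀ S : Type u, (S → S → S → Prop) → S → S → S → Prop}
    (hT : FODef (Fin 3) fun S R v => T S R (v 0) (v 1) (v 2)) (σ : DefinitionScheme) :
    ∃ σ' : DefinitionScheme, ∀ (P S S' : Type u) (𝓖 : Set (Set P)) (R : S → S → S → Prop)
      (R' : S' → S' → S' → Prop) (mem : S' → S → Prop) (e : _ → S') (inc' : P → S' → Prop)
      (inc : P → S → Prop), IsPairCoding (T S R) R' mem e → σ.DefinesRel 𝓖 R' inc' →
      (∀ p a, inc p a ↔ ∃ c, inc' p c ∧ mem c a) → σ'.DefinesRel 𝓖 R inc := by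
  obtain ⟨P₁, hP₁, h₁⟩ := exists_translation hT σ.isPoint
  obtain ⟨P₂, hP₂, h₂⟩ := exists_translation hT σ.samePoint
  obtain ⟨P₃, hP₃, h₃⟩ := exists_translation hT σ.isLine
  obtain ⟨P₄, hP₄, h₄⟩ := exists_translation hT σ.onLine
  obtain ⟨P₅, hP₅, h₅⟩ := exists_translation hT σ.onElement
  -- Tuples of pairs are flattened to tuples of twice the length.
  let ε := Fintype.equivFin (Fin σ.n × Bool)
  let δ := Fintype.equivFin (Fin σ.r × Bool)
  obtain ⟨φ₁, hφ₁⟩ := (FODef.forall_finite fun a : Fin σ.n =>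
    hT.share (ε (a, false)) (ε (a, true))).and (hP₁.comp ε)
  obtain ⟨φ₂, hφ₂⟩ := hP₂.comp (fun i : (Fin σ.n ⊕ Fin σ.n) × Bool =>
    Sum.map (fun a => ε (a, i.2)) (fun a => ε (a, i.2)) i.1)
  obtain ⟨φ₃, hφ₃⟩ := (FODef.forall_finite fun a : Fin σ.r =>
    hT.share (δ (a, false)) (δ (a, true))).and (hP₃.comp δ)
  obtain ⟨φ₄, hφ₄⟩ := hP₄.comp (fun i : (Fin σ.n ⊕ Fin σ.r) × Bool =>
    Sum.map (fun a => ε (a, i.2)) (fun a => δ (a, i.2)) i.1)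
  let g : (Fin σ.n ⊕ Fin 1) × Bool →
      ((Fin (Fintype.card (Fin σ.n × Bool)) ⊕ Fin 1) ⊕ Unit) ⊕ Unit := fun i =>
    Sum.elim (fun a => Sum.inl (Sum.inl (Sum.inl (ε (a, i.2)))))
      (fun _ => cond i.2 (Sum.inr ()) (Sum.inl (Sum.inr ()))) i.1
  let ext : ∀ S : Type u, (Fin (Fintype.card (Fin σ.n × Bool)) ⊕ Fin 1 → S) → S → S →
      (Fin σ.n ⊕ Fin 1) × Bool → S :=
    fun S v x y => Sum.elim (Sum.elim v fun _ => x) (fun _ => y) ∘ g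
  -- A point lies on an element exactly when it lies on some coded subspace inside that element, so
  -- this formula quantifies over one more pair.
  have hdef : FODef (Fin (Fintype.card (Fin σ.n × Bool)) ⊕ Fin 1) fun S R v =>
      ∃ x y, Share (T S R) x y ∧ Contains (T S R) x y (v (Sum.inr 0)) ∧ P₅ S R (ext S v x y) := by
    refine FODef.ex (FODef.ex ((hT.share _ _).and ((hT.contains _ _ _).and ?_)))
    convert hP₅.comp g using 4
    refine Iff.of_eq (congrArg _ (funext fun i => ?_))
    simp only [ext, Function.comp]
    generalize g i = z
    rcases z with (z | z) | z <;> rfl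
  obtain ⟨φ₅, hφ₅⟩ := hdef
  refine ⟨⟨_, _, φ₁, φ₂, φ₃, φ₄, φ₅⟩, ?_⟩
  intro P S S' 𝓖 R R' mem e inc' inc hc ⟨f₀, g₀, hf₀, hg₀, hsame, hline, helem⟩ hinc
  -- decoding of tuples
  have dec : ∀ {n : ℕ} (η : Fin n × Bool ≃ Fin (Fintype.card (Fin n × Bool)))
      (x : Fin (Fintype.card (Fin n × Bool)) → S),
      (∀ a, Share (T S R) (x (η (a, false))) (x (η (a, true)))) →
      ∃ w : Fin n → {p : S × S // Share (T S R) p.1 p.2}, unpair w = x ∘ η := by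
    intro n η x hx
    refine ⟨fun a => ⟨(x (η (a, false)), x (η (a, true))), hx a⟩, ?_⟩
    funext ⟨a, b⟩
    cases b <;> rfl
  have enc : ∀ {n : ℕ} (η : Fin n × Bool ≃ Fin (Fintype.card (Fin n × Bool)))
      (w : Fin n → {p : S × S // Share (T S R) p.1 p.2}),
      ∃ x : Fin (Fintype.card (Fin n × Bool)) → S, unpair w = x ∘ η ∧
        ∀ a, Share (T S R) (x (η (a, false))) (x (η (a, true))) := by
    intro n η w
    refine ⟨unpair w ∘ η.symm, by funext i; simp, fun a => ?_⟩
    simp only [Function.comp, Equiv.symm_apply_apply]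
    exact (w a).2
  have unpair_inj : ∀ {n : ℕ} (w w' : Fin n → {p : S × S // Share (T S R) p.1 p.2}),
      unpair w = unpair w' → w = w' := by
    intro n w w' h
    funext a
    exact Subtype.ext (Prod.ext (congrFun h (a, false)) (congrFun h (a, true)))
  have fex : ∀ x : {x // Holds R φ₁ x}, ∃ w : Fin σ.n → {p : S × S // Share (T S R) p.1 p.2},
      unpair w = x.1 ∘ ε ∧ Holds R' σ.isPoint (fun i => e (w i)) := by
    rintro ⟨x, hx⟩
    obtain ⟨h1, h2⟩ := (hφ₁ S R x).1 hx
    obtain ⟨w, hw⟩ := dec ε x h1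
    exact ⟨w, hw, (h₁ S S' R R' mem e hc w).2 (hw ▸ h2)⟩
  have gex : ∀ x : {x // Holds R φ₃ x}, ∃ w : Fin σ.r → {p : S × S // Share (T S R) p.1 p.2},
      unpair w = x.1 ∘ δ ∧ Holds R' σ.isLine (fun i => e (w i)) := by
    rintro ⟨x, hx⟩
    obtain ⟨h1, h2⟩ := (hφ₃ S R x).1 hx
    obtain ⟨w, hw⟩ := dec δ x h1
    exact ⟨w, hw, (h₃ S S' R R' mem e hc w).2 (hw ▸ h2)⟩
  choose wf hwf hwf' using fex
  choose wg hwg hwg' using gex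
  refine ⟨fun x => f₀ ⟨_, hwf' x⟩, fun y => g₀ ⟨_, hwg' y⟩, ?_, ?_, ?_, ?_, ?_⟩
  · intro p
    obtain ⟨⟨z, hz⟩, rfl⟩ := hf₀ p
    choose w hw using fun i => hc.surjective (z i)
    obtain rfl : (fun i => e (w i)) = z := funext hw
    obtain ⟨x, hx, hx'⟩ := enc ε w
    have hxφ : Holds R φ₁ x := (hφ₁ S R x).2 ⟨hx', show P₁ S R (x ∘ ε) from
      hx ▸ (h₁ S S' R R' mem e hc w).1 hz⟩
    have hwx := unpair_inj _ w ((hwf ⟨x, hxφ⟩).trans hx.symm)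
    exact ⟨⟨x, hxφ⟩, congrArg f₀ (Subtype.ext (by simp only [hwx]))⟩
  · intro p
    obtain ⟨⟨z, hz⟩, rfl⟩ := hg₀ p
    choose w hw using fun i => hc.surjective (z i)
    obtain rfl : (fun i => e (w i)) = z := funext hw
    obtain ⟨x, hx, hx'⟩ := enc δ w
    have hxφ : Holds R φ₃ x := (hφ₃ S R x).2 ⟨hx', show P₃ S R (x ∘ δ) from
      hx ▸ (h₃ S S' R R' mem e hc w).1 hz⟩
    have hwx := unpair_inj _ w ((hwg ⟨x, hxφ⟩).trans hx.symm)
    exact ⟨⟨x, hxφ⟩, congrArg g₀ (Subtype.ext (by simp only [hwx]))⟩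
  · intro x x'
    rw [hsame]
    refine Iff.trans (Iff.of_eq ?_) ((h₂ S S' R R' mem e hc (Sum.elim (wf x) (wf x'))).trans
      (Iff.trans (Iff.of_eq ?_) (hφ₂ S R _).symm))
    · congr 1; funext i; cases i <;> rfl
    · congr 1
      funext ⟨i, b⟩
      rcases i with i | i
      · exact congrFun (hwf x) (i, b)
      · exact congrFun (hwf x') (i, b)
  · intro x y
    rw [hline]
    refine Iff.trans (Iff.of_eq ?_) ((h₄ S S' R R' mem e hc (Sum.elim (wf x) (wg y))).trans
      (Iff.trans (Iff.of_eq ?_) (hφ₄ S R _).symm))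
    · congr 1; funext i; cases i <;> rfl
    · congr 1
      funext ⟨i, b⟩
      rcases i with i | i
      · exact congrFun (hwf x) (i, b)
      · exact congrFun (hwg y) (i, b)
  · intro x A
    rw [hinc, hφ₅, hc.surjective.exists]
    have key : ∀ q, inc' (f₀ ⟨_, hwf' x⟩) (e q) ↔
        P₅ S R (ext S (Sum.elim x.1 fun _ => A) q.1.1 q.1.2) := by
      intro q
      rw [helem]
      refine Iff.trans (Iff.of_eq ?_) ((h₅ S S' R R' mem e hc
        (Sum.elim (wf x) (fun _ => q))).trans (Iff.of_eq ?_))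
      · congr 1; funext i; cases i <;> rfl
      · congr 1
        funext ⟨i, b⟩
        rcases i with i | i
        · exact congrFun (hwf x) (i, b)
        · cases b <;> rfl
    simp only [key, hc.mem_iff]
    exact ⟨fun ⟨q, h1, h2⟩ => ⟨_, _, q.2, h2, h1⟩, fun ⟨a, b, h1, h2, h3⟩ => ⟨⟨(a, b), h1⟩, h3, h2⟩⟩

open FirstOrder Language in
/-- Definitions are transported along isomorphisms. -/
theorem DefinitionScheme.DefinesRel.of_equiv {σ : DefinitionScheme} {P S S' : Type*}
    {𝓖 : Set (Set P)} {R : S → S → S → Prop} {R' : S' → S' → S' → Prop} {inc : P → S → Prop}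
    {inc' : P → S' → Prop} (θ : S ≃ S') (hR : ∀ a b c, R' (θ a) (θ b) (θ c) ↔ R a b c)
    (hinc : ∀ p a, inc' p (θ a) ↔ inc p a) (h : σ.DefinesRel 𝓖 R inc) :
    σ.DefinesRel 𝓖 R' inc' := by
  have key : ∀ {α : Type} (φ : collinearityLang.Formula α) (v : α → S'),
      Holds R φ (θ.symm ∘ v) ↔ Holds R' φ v := by
    intro α φ v
    let := relStructure R
    let := relStructure R'
    let Θ : S ≃[collinearityLang] S' :=
      { θ with
        map_fun' := fun f => f.elim
        map_rel' := fun r x => by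
          cases r
          exact hR (x 0) (x 1) (x 2) }
    have := StrongHomClass.realize_formula Θ φ (v := θ.symm ∘ v)
    refine Iff.trans this.symm (Iff.of_eq ?_)
    unfold Holds
    congr 1
    funext i
    exact θ.apply_symm_apply (v i)
  obtain ⟨f, g, hf, hg, h1, h2, h3⟩ := h
  refine ⟨fun x => f ⟨_, (key _ x.1).2 x.2⟩, fun y => g ⟨_, (key _ y.1).2 y.2⟩, ?_, ?_, ?_, ?_, ?_⟩
  · intro p
    obtain ⟨⟨x, hx⟩, rfl⟩ := hf p
    have e : θ.symm ∘ θ ∘ x = x := by funext i; simp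
    exact ⟨⟨θ ∘ x, (key _ _).1 (e.symm ▸ hx)⟩, congrArg f (Subtype.ext e)⟩
  · intro p
    obtain ⟨⟨x, hx⟩, rfl⟩ := hg p
    have e : θ.symm ∘ θ ∘ x = x := by funext i; simp
    exact ⟨⟨θ ∘ x, (key _ _).1 (e.symm ▸ hx)⟩, congrArg g (Subtype.ext e)⟩
  · intro x x'
    refine (h1 _ _).trans (Iff.trans (Iff.of_eq ?_) (key _ _))
    congr 1; funext i; cases i <;> rfl
  · intro x y
    refine (h2 _ _).trans (Iff.trans (Iff.of_eq ?_) (key _ _))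
    congr 1; funext i; cases i <;> rfl
  · intro x A
    obtain ⟨a, rfl⟩ := θ.surjective A
    refine (hinc _ _).trans ((h3 _ _).trans (Iff.trans (Iff.of_eq ?_) (key _ _)))
    congr 1; funext i; cases i
    · rfl
    · exact (θ.symm_apply_apply a).symm

/-! ### The case of points, and the descent on the dimension -/

namespace PolarSpace

variable {Q : Type u} {𝔔 : PolarSpace Q} {H : Set Q} {n m : ℕ}

theorem exists_ne_of_line {L : Set Q} (hL : L ∈ 𝔔.lines) : ∃ a ∈ L, ∃ b ∈ L, a ≠ b := by
  have h3 := 𝔔.three_le_card L hL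
  have : 1 < L.encard := lt_of_lt_of_le (by norm_num) h3
  obtain ⟨a, b, ha, hb, hab⟩ := Set.one_lt_encard_iff.1 this
  exact ⟨a, ha, b, hb, hab⟩

theorem rk_line (hf : 𝔔.FiniteRank) {L : Set Q} (hL : L ∈ 𝔔.lines) : 𝔔.Rk L 2 := by
  have hLs : 𝔔.IsSubspace L := fun M hM a b hab ha hb haL hbL =>
    (𝔔.unique_line M hM L hL a b hab ha hb haL hbL).subset
  obtain ⟨a, ha, b, hb, hab⟩ := exists_ne_of_line hL
  have hJ := (rk_singleton hf a).join hf (a := b)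
    (by rintro _ rfl; exact Or.inr ⟨L, hL, ha, hb⟩) (fun h => hab (Set.mem_singleton_iff.1 h).symm)
  have : 𝔔.join {a} b = L := Set.Subset.antisymm
    (join_subset hLs (Set.singleton_subset_iff.2 ha) hb)
    (isSubspace_join {a} b L hL a b hab ha hb (subset_join {a} b rfl) (mem_join {a} b))
  exact this ▸ hJ

theorem Rk.eq_line (hf : 𝔔.FiniteRank) {B L : Set Q} (hB : 𝔔.Rk B 2) (hL : L ∈ 𝔔.lines) {a b : Q}
    (hab : a ≠ b) (ha : a ∈ L) (hb : b ∈ L) (haB : a ∈ B) (hbB : b ∈ B) : L = B :=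
  (rk_line hf hL).eq_of_subset hB (hB.isStrong.1 L hL a b hab ha hb haB hbB)

theorem affColExt_zero_iff {X Y Z : 𝔔.El H 0} :
    𝔔.affColExt H 0 X Y Z ↔ ∃ B, 𝔔.Rk B 2 ∧ X.1 ⊆ B ∧ Y.1 ⊆ B ∧ Z.1 ⊆ B := by
  constructor
  · rintro ⟨-, B, -, hB, -, h⟩
    exact ⟨B, hB, h⟩
  · rintro ⟨B, hB, h⟩
    exact ⟨∅, B, rk_empty, hB, ⟨Set.empty_subset _, Set.empty_subset _, Set.empty_subset _⟩, h⟩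

end PolarSpace

open FirstOrder Language PolarSpace

/-- The affine polar space is definable in itself, its points being given as singletons. -/
theorem exists_scheme_points :
    ∃ σ : DefinitionScheme, ∀ (Q : Type u) (𝔔 : PolarSpace Q) (H : Set Q),
      𝔔.FiniteRank → 𝔔.IsHyperplane H →
        σ.DefinesRel (𝔔.affLines H) (𝔔.affColExt H 0) (fun a A => a.1 ∈ A.1) := by
  obtain ⟨φ₁, h₁⟩ := FODef.top.{u} (α := Fin 1)
  obtain ⟨φ₂, h₂⟩ := FODef.eq.{u} (Sum.inl 0 : Fin 1 ⊕ Fin 1) (Sum.inr 0)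
  obtain ⟨φ₃, h₃⟩ := FODef.adj (FODef.rel.{u} (0 : Fin 3) 1 2) (0 : Fin 2) 1
  obtain ⟨φ₄, h₄⟩ := FODef.rel.{u} (Sum.inr 0 : Fin 1 ⊕ Fin 2) (Sum.inr 1) (Sum.inl 0)
  -- Equality serves both for equal points and for a point on an element, since elements are
  -- singletons here; lines are coded by pairs of adjacent points.
  refine ⟨⟨1, 2, φ₁, φ₂, φ₃, φ₄, φ₂⟩, fun Q 𝔔 H hf hH => ?_⟩
  have ptex : ∀ X : 𝔔.El H 0, ∃ a : ↥(Hᶜ), X.1 = {a.1} := fun X => by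
    obtain ⟨a, ha, haH⟩ := Set.not_subset.1 X.2.2
    exact ⟨⟨a, haH⟩, X.2.1.eq_singleton hf ha⟩
  choose pt hpt using ptex
  let mk : ↥(Hᶜ) → 𝔔.El H 0 := fun a => ⟨{a.1}, rk_singleton hf a.1, fun h => a.2 (h rfl)⟩
  have pt_mk : ∀ a, pt (mk a) = a := fun a =>
    Subtype.ext (Set.singleton_injective (hpt (mk a)).symm)
  have mk_pt : ∀ X, mk (pt X) = X := fun X => Subtype.ext (hpt X).symm
  have pt_inj : ∀ X Y, pt X = pt Y ↔ X = Y := fun X Y =>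
    ⟨fun h => by rw [← mk_pt X, h, mk_pt], fun h => h ▸ rfl⟩
  have col_iff : ∀ (X Y Z : 𝔔.El H 0) (L : Set Q), L ∈ 𝔔.lines → X ≠ Y → (pt X).1 ∈ L →
      (pt Y).1 ∈ L → (𝔔.affColExt H 0 X Y Z ↔ (pt Z).1 ∈ L) := by
    intro X Y Z L hL hXY hX hY
    rw [affColExt_zero_iff]
    constructor
    · rintro ⟨B, hB, hXB, hYB, hZB⟩
      rw [hpt, Set.singleton_subset_iff] at hXB hYB hZB
      have := hB.eq_line hf hL (fun h => hXY ((pt_inj X Y).1 (Subtype.ext h))) hX hY hXB hYB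
      exact this ▸ hZB
    · intro hZ
      refine ⟨L, rk_line hf hL, ?_, ?_, ?_⟩ <;> rw [hpt, Set.singleton_subset_iff] <;> assumption
  have line_of_adj : ∀ X Y : 𝔔.El H 0, Adj (𝔔.affColExt H 0) X Y →
      ∃ L ∈ 𝔔.lines, (pt X).1 ∈ L ∧ (pt Y).1 ∈ L := by
    rintro X Y ⟨hne, h⟩
    obtain ⟨B, hB, hX, hY, -⟩ := affColExt_zero_iff.1 h
    rw [hpt, Set.singleton_subset_iff] at hX hY
    exact (hB.isStrong.2 _ hX _ hY).resolve_left
      (fun h => hne ((pt_inj X Y).1 (Subtype.ext h)))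
  refine ⟨fun x => pt (x.1 0),
    fun y => ⟨{a | 𝔔.affColExt H 0 (y.1 0) (y.1 1) (mk a)}, ?_⟩, ?_, ?_, ?_, ?_, ?_⟩
  · have hadj : Adj (𝔔.affColExt H 0) (y.1 0) (y.1 1) := (h₃ _ _ _).1 y.2
    obtain ⟨L, hL, hX, hY⟩ := line_of_adj _ _ hadj
    have heq : {a | 𝔔.affColExt H 0 (y.1 0) (y.1 1) (mk a)} = Subtype.val ⁻¹' L := by
      ext a
      rw [Set.mem_ofPred_eq, col_iff _ _ _ L hL hadj.1 hX hY, pt_mk, Set.mem_preimage]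
    rw [heq]
    exact ⟨⟨_, hX⟩, L, hL, rfl⟩
  · intro a
    exact ⟨⟨fun _ => mk a, (h₁ _ _ _).2 trivial⟩, pt_mk a⟩
  · rintro ⟨l, ⟨a, ha⟩, L, hL, rfl⟩
    have hLr := rk_line hf hL
    -- A nonempty trace of a line has a second point: the line is not the union of `{a}` and its
    -- part in `H`.
    obtain ⟨b, hb, hba, hbH⟩ := exists_notMem_union hLr.isStrong (isStrong_singleton a.1).1 hH.1
      ((rk_singleton hf a.1).not_subset hLr (by omega)) (fun h => a.2 (h ha))
    have hne : mk a ≠ mk ⟨b, hbH⟩ := fun h => hba (by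
      have := congrArg pt h
      rw [pt_mk, pt_mk] at this
      exact congrArg Subtype.val this.symm)
    have hc : ∀ c, 𝔔.affColExt H 0 (mk a) (mk ⟨b, hbH⟩) (mk c) ↔ c.1 ∈ L := fun c => by
      rw [col_iff _ _ _ L hL hne (by rw [pt_mk]; exact ha) (by rw [pt_mk]; exact hb), pt_mk]
    refine ⟨⟨![mk a, mk ⟨b, hbH⟩], (h₃ _ _ _).2 ⟨hne, (hc _).2 hb⟩⟩, Subtype.ext ?_⟩
    ext c
    exact hc c
  · intro x x'
    refine Iff.trans ?_ (h₂ _ _ _).symm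
    exact pt_inj _ _
  · intro x y
    refine Iff.trans ?_ (h₄ _ _ _).symm
    change 𝔔.affColExt H 0 (y.1 0) (y.1 1) (mk (pt (x.1 0))) ↔ _
    rw [mk_pt]
    rfl
  · intro x A
    refine Iff.trans ?_ (h₂ _ _ _).symm
    change (pt (x.1 0)).1 ∈ A.1 ↔ x.1 0 = A
    rw [hpt A, Set.mem_singleton_iff, ← pt_inj]
    exact ⟨fun h => Subtype.ext h, fun h => congrArg Subtype.val h⟩

/-- The subspaces of corank one in the elements are coded by pairs of elements. -/
theorem PolarSpace.exists_isPairCoding {Q : Type u} {𝔔 : PolarSpace Q} {H : Set Q} {n m : ℕ}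
    (hm : 𝔔.HasIndex m) (hnm : n + 2 ≤ m) (hH : 𝔔.IsHyperplane H) :
    ∃ e, IsPairCoding (𝔔.affCol H (n + 1)) (𝔔.affColExt H n) (fun C A => C.1 ⊆ A.1) e := by
  have hf := hm.finiteRank
  have hn : 1 ≤ n + 1 := by omega
  have hnm' : n + 1 + 1 ≤ m := hnm
  have hb := fun p : {p : 𝔔.El H (n + 1) × 𝔔.El H (n + 1) //
    Share (𝔔.affCol H (n + 1)) p.1 p.2} => p.2.exists_base hf hH hn
  refine ⟨fun p => ⟨p.1.1.1 ∩ p.1.2.1, (hb p).1, (hb p).2.1⟩, ?_, ?_, ?_, ?_⟩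
  · rintro ⟨C, hC, hCH⟩
    obtain ⟨X, Y, hS, h⟩ := exists_share hm hnm' hH hn hC hCH
    exact ⟨⟨(X, Y), hS⟩, Subtype.ext h⟩
  · intro p q
    rw [contains_iff hm hnm' hH hn p.2, contains_iff hm hnm' hH hn p.2, ← Set.subset_inter_iff,
      Subtype.mk.injEq]
    exact ⟨fun h => h.subset, fun h => (hb p).1.eq_of_subset (hb q).1 h⟩
  · intro p q r
    exact (stepCol_iff hm hnm hH p.2 q.2 r.2 rfl rfl rfl).symm
  · intro p a
    exact (contains_iff hm hnm' hH hn p.2).symm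

theorem PolarSpace.mem_iff_exists_corank_one {Q : Type u} {𝔔 : PolarSpace Q} {H : Set Q} {n : ℕ}
    (hf : 𝔔.FiniteRank) (a : ↥(Hᶜ)) (A : 𝔔.El H (n + 1)) :
    a.1 ∈ A.1 ↔ ∃ C : 𝔔.El H n, a.1 ∈ C.1 ∧ C.1 ⊆ A.1 := by
  constructor
  · intro h
    obtain ⟨C, hC, haC, hCA⟩ := exists_corank_one hf A.2.1 h
    exact ⟨⟨C, hC, fun h => a.2 (h haC)⟩, haC, hCA⟩
  · rintro ⟨C, haC, hCA⟩
    exact hCA haC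

/-- Each step first replaces extended collinearity by proper collinearity through `ProperCol`, then
passes to the subspaces of corank one, on which extended collinearity is again available. -/
theorem exists_scheme_affColExt (k : ℕ) : ∀ m, k < m →
    ∃ σ : DefinitionScheme, ∀ (Q : Type u) (𝔔 : PolarSpace Q) (H : Set Q),
      𝔔.HasIndex m → 𝔔.IsHyperplane H →
        σ.DefinesRel (𝔔.affLines H) (𝔔.affColExt H k) (fun a A => a.1 ∈ A.1) := by
  induction k with
  | zero =>
    intro m _
    obtain ⟨σ, h⟩ := exists_scheme_points.{u}
    exact ⟨σ, fun Q 𝔔 H hm hH => h Q 𝔔 H hm.finiteRank hH⟩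
  | succ k ih =>
    intro m hkm
    obtain ⟨σ, h⟩ := ih m (by omega)
    obtain ⟨σ', h'⟩ := σ.exists_comp (FODef.properCol.{u} (0 : Fin 3) 1 2)
    refine ⟨σ', fun Q 𝔔 H hm hH => ?_⟩
    have hf := hm.finiteRank
    have hR : ProperCol (𝔔.affColExt H (k + 1)) = 𝔔.affCol H (k + 1) := by
      funext X Y Z
      exact propext (properCol_iff hf hH)
    have hc := exists_isPairCoding hm (n := k) (by omega) hH
    rw [← hR] at hc
    obtain ⟨e, he⟩ := hc
    exact h' _ _ _ _ _ _ _ _ _ _ he (h Q 𝔔 H hm hH) (mem_iff_exists_corank_one hf)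

/-- Proper collinearity is given, so the first descent needs no detection of parallels; below it the
extended structure takes over. -/
theorem exists_scheme_affCol (k m : ℕ) (hkm : k + 1 < m) :
    ∃ σ : DefinitionScheme, ∀ (Q : Type u) (𝔔 : PolarSpace Q) (H : Set Q),
      𝔔.HasIndex m → 𝔔.IsHyperplane H →
        σ.DefinesRel (𝔔.affLines H) (𝔔.affCol H (k + 1)) (fun a A => a.1 ∈ A.1) := by
  obtain ⟨σ, h⟩ := exists_scheme_affColExt.{u} k m (by omega)
  obtain ⟨σ', h'⟩ := σ.exists_comp (T := fun _ R => R) (FODef.rel.{u} (0 : Fin 3) 1 2)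
  refine ⟨σ', fun Q 𝔔 H hm hH => ?_⟩
  obtain ⟨e, he⟩ := exists_isPairCoding hm (n := k) (by omega) hH
  exact h' _ _ _ _ _ _ _ _ _ _ he (h Q 𝔔 H hm hH) (mem_iff_exists_corank_one hm.finiteRank)

/-! ### From strong subspaces to their affine parts -/

namespace PolarSpace

variable {Q : Type u} {𝔔 : PolarSpace Q} {H : Set Q} {k m : ℕ}

theorem diff_subset_diff_iff (hH : 𝔔.IsHyperplane H) {X Y : Set Q} (hX : 𝔔.IsStrong X)
    (hXH : ¬ X ⊆ H) (hY : 𝔔.IsStrong Y) : X \ H ⊆ Y \ H ↔ X ⊆ Y :=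
  ⟨fun h => subset_of_diff_subset hH.1 hX hXH hY.1 (h.trans Set.sdiff_subset),
    fun h => Set.sdiff_subset_sdiff_left h⟩

variable (k) in
/-- Elements correspond to their affine parts. -/
theorem exists_equiv_affSub (hH : 𝔔.IsHyperplane H) :
    ∃ θ : 𝔔.El H k ≃ ↥(𝔔.affSub H k), ∀ X, (θ X).1 = X.1 \ H := by
  let f : 𝔔.El H k → ↥(𝔔.affSub H k) := fun X =>
    ⟨X.1 \ H, X.1, (mem_sub_iff (by omega)).2 X.2.1, Or.inr X.2.2, rfl⟩
  refine ⟨Equiv.ofBijective f ⟨fun X Y h => ?_, ?_⟩, fun X => rfl⟩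
  · have h' : X.1 \ H = Y.1 \ H := congrArg Subtype.val h
    exact Subtype.ext (Set.Subset.antisymm
      ((diff_subset_diff_iff hH X.2.1.isStrong X.2.2 Y.2.1.isStrong).1 h'.subset)
      ((diff_subset_diff_iff hH Y.2.1.isStrong Y.2.2 X.2.1.isStrong).1 h'.symm.subset))
  · rintro ⟨A, X, hX, hXH, rfl⟩
    exact ⟨⟨X, (mem_sub_iff (by omega)).1 hX, hXH.resolve_left (by omega)⟩, rfl⟩

theorem exists_mem_affPencils_iff (hH : 𝔔.IsHyperplane H)
    (θ : 𝔔.El H (k + 1) ≃ ↥(𝔔.affSub H (k + 1 : ℕ))) (hθ : ∀ X, (θ X).1 = X.1 \ H)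
    (X Y Z : 𝔔.El H (k + 1)) :
    (∃ l ∈ 𝔔.affPencils H (k + 1), θ X ∈ l ∧ θ Y ∈ l ∧ θ Z ∈ l) ↔
      𝔔.affCol H (k + 1) X Y Z := by
  constructor
  · rintro ⟨_, ⟨_, ⟨C, hC, hCH, rfl⟩, _, ⟨B, hB, -, rfl⟩, -, rfl⟩, hX, hY, hZ⟩
    have hC' : 𝔔.Rk C (k + 1) := (mem_sub_iff (by omega)).1 hC
    have hB' : 𝔔.Rk B (k + 1 + 2) := (mem_sub_iff (by omega)).1 hB
    have hCH' := hCH.resolve_left (by omega)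
    have key : ∀ W : 𝔔.El H (k + 1), C \ H ⊆ (θ W).1 ∧ (θ W).1 ⊆ B \ H → C ⊆ W.1 ∧ W.1 ⊆ B := by
      intro W
      rw [hθ, diff_subset_diff_iff hH hC'.isStrong hCH' W.2.1.isStrong,
        diff_subset_diff_iff hH W.2.1.isStrong W.2.2 hB'.isStrong]
      exact id
    exact ⟨C, B, hC', hB', hCH', ⟨(key X hX).1, (key Y hY).1, (key Z hZ).1⟩, (key X hX).2,
      (key Y hY).2, (key Z hZ).2⟩
  · rintro ⟨C, B, hC, hB, hCH, ⟨h1, h2, h3⟩, h4, h5, h6⟩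
    have hB' : B ∈ 𝔔.sub (((k + 1 : ℕ) : ℤ) + 1) := (mem_sub_iff (by omega)).2 hB
    have hC' : C ∈ 𝔔.sub (((k + 1 : ℕ) : ℤ) - 1) := (mem_sub_iff (by omega)).2 hC
    refine ⟨_, ⟨C \ H, ⟨C, hC', Or.inr hCH, rfl⟩, B \ H,
      ⟨B, hB', Or.inr fun h => X.2.2 (h4.trans h), rfl⟩,
      Set.sdiff_subset_sdiff_left (h1.trans h4), rfl⟩, ?_, ?_, ?_⟩
    · exact ⟨hθ X ▸ Set.sdiff_subset_sdiff_left h1, hθ X ▸ Set.sdiff_subset_sdiff_left h4⟩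
    · exact ⟨hθ Y ▸ Set.sdiff_subset_sdiff_left h2, hθ Y ▸ Set.sdiff_subset_sdiff_left h5⟩
    · exact ⟨hθ Z ▸ Set.sdiff_subset_sdiff_left h3, hθ Z ▸ Set.sdiff_subset_sdiff_left h6⟩

/-- In dimension `0` the bottom of a pencil is `∅`, which lies in `H` yet is admitted among affine
subspaces. So the pencils correspond to `affColExt`, whereas `affCol H 0` is empty. -/
theorem exists_mem_affPencils_zero_iff (hH : 𝔔.IsHyperplane H)
    (θ : 𝔔.El H 0 ≃ ↥(𝔔.affSub H (0 : ℕ))) (hθ : ∀ X, (θ X).1 = X.1 \ H) (X Y Z : 𝔔.El H 0) :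
    (∃ l ∈ 𝔔.affPencils H 0, θ X ∈ l ∧ θ Y ∈ l ∧ θ Z ∈ l) ↔ 𝔔.affColExt H 0 X Y Z := by
  rw [affColExt_zero_iff]
  constructor
  · rintro ⟨_, ⟨_, -, _, ⟨B, hB, -, rfl⟩, -, rfl⟩, hX, hY, hZ⟩
    have hB' : 𝔔.Rk B 2 := (mem_sub_iff (by omega)).1 hB
    have key : ∀ W : 𝔔.El H 0, (θ W).1 ⊆ B \ H → W.1 ⊆ B := by
      intro W
      rw [hθ, diff_subset_diff_iff hH W.2.1.isStrong W.2.2 hB'.isStrong]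
      exact id
    exact ⟨B, hB', key X hX.2, key Y hY.2, key Z hZ.2⟩
  · rintro ⟨B, hB, h4, h5, h6⟩
    have hB' : B ∈ 𝔔.sub (((0 : ℕ) : ℤ) + 1) := (mem_sub_iff (by omega)).2 hB
    have hC' : ∅ ∈ 𝔔.sub (((0 : ℕ) : ℤ) - 1) := (mem_sub_iff (by omega)).2 rk_empty
    refine ⟨_, ⟨∅, ⟨∅, hC', Or.inl (by omega), (Set.empty_sdiff H).symm⟩, B \ H,
      ⟨B, hB', Or.inr fun h => X.2.2 (h4.trans h), rfl⟩, Set.empty_subset _, rfl⟩, ?_, ?_, ?_⟩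
    · exact ⟨Set.empty_subset _, hθ X ▸ Set.sdiff_subset_sdiff_left h4⟩
    · exact ⟨Set.empty_subset _, hθ Y ▸ Set.sdiff_subset_sdiff_left h5⟩
    · exact ⟨Set.empty_subset _, hθ Z ▸ Set.sdiff_subset_sdiff_left h6⟩

theorem exists_mem_affPencilsExt_iff (hH : 𝔔.IsHyperplane H)
    (θ : 𝔔.El H k ≃ ↥(𝔔.affSub H k)) (hθ : ∀ X, (θ X).1 = X.1 \ H) (X Y Z : 𝔔.El H k) :
    (∃ l ∈ 𝔔.affPencilsExt H k, θ X ∈ l ∧ θ Y ∈ l ∧ θ Z ∈ l) ↔ 𝔔.affColExt H k X Y Z := by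
  have key : ∀ (C B : Set Q) (W : 𝔔.El H k),
      (∃ X ∈ 𝔔.pencil k C B, ¬ X ⊆ H ∧ (θ W).1 = X \ H) ↔ C ⊆ W.1 ∧ W.1 ⊆ B := by
    intro C B W
    constructor
    · rintro ⟨V, ⟨hV, hCV, hVB⟩, hVH, h⟩
      have hV' : 𝔔.Rk V (k + 1) := (mem_sub_iff (by omega)).1 hV
      rw [hθ] at h
      have : W.1 = V := Set.Subset.antisymm
        ((diff_subset_diff_iff hH W.2.1.isStrong W.2.2 hV'.isStrong).1 h.subset)
        ((diff_subset_diff_iff hH hV'.isStrong hVH W.2.1.isStrong).1 h.symm.subset)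
      exact this ▸ ⟨hCV, hVB⟩
    · rintro ⟨hC, hB⟩
      exact ⟨W.1, ⟨(mem_sub_iff (by omega)).2 W.2.1, hC, hB⟩, W.2.2, hθ W⟩
  constructor
  · rintro ⟨_, ⟨-, _, ⟨C, hC, B, hB, -, rfl⟩, rfl⟩, hX, hY, hZ⟩
    have hX := (key C B X).1 hX
    have hY := (key C B Y).1 hY
    have hZ := (key C B Z).1 hZ
    exact ⟨C, B, (mem_sub_iff (by omega)).1 hC, (mem_sub_iff (by omega)).1 hB,
      ⟨hX.1, hY.1, hZ.1⟩, hX.2, hY.2, hZ.2⟩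
  · rintro ⟨C, B, hC, hB, ⟨h1, h2, h3⟩, h4, h5, h6⟩
    have hX := (key C B X).2 ⟨h1, h4⟩
    exact ⟨_, ⟨⟨θ X, hX⟩, _, ⟨C, (mem_sub_iff (by omega)).2 hC, B,
      (mem_sub_iff (by omega)).2 hB, h1.trans h4, rfl⟩, rfl⟩, hX,
      (key C B Y).2 ⟨h2, h5⟩, (key C B Z).2 ⟨h3, h6⟩⟩

end PolarSpace

theorem mem_iff_of_eq_diff {Q : Type*} {H A X : Set Q} (a : ↥(Hᶜ)) (h : A = X \ H) :
    a.1 ∈ A ↔ a.1 ∈ X := by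
  subst h
  exact ⟨fun h => h.1, fun h => ⟨h, a.2⟩⟩

theorem corollary1p6 (m k : ℕ) (hkm : k < m) :
    (∃ σ : DefinitionScheme, ∀ (Q : Type*) (𝔔 : PolarSpace Q) (H : Set Q),
      𝔔.HasIndex m → 𝔔.IsHyperplane H →
        σ.Defines (𝔔.affLines H) (𝔔.affPencils H k) (fun a A => a.1 ∈ A.1)) ∧
    (∃ σ : DefinitionScheme, ∀ (Q : Type*) (𝔔 : PolarSpace Q) (H : Set Q),
      𝔔.HasIndex m → 𝔔.IsHyperplane H →
        σ.Defines (𝔔.affLines H) (𝔔.affPencilsExt H k) (fun a A => a.1 ∈ A.1)) := by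
  constructor
  · cases k with
    | zero =>
      obtain ⟨σ, h⟩ := exists_scheme_affColExt 0 m hkm
      refine ⟨σ, fun Q 𝔔 H hm hH => ?_⟩
      obtain ⟨θ, hθ⟩ := PolarSpace.exists_equiv_affSub 0 hH
      exact (σ.defines_iff _ _ _).2 ((h Q 𝔔 H hm hH).of_equiv θ
        (PolarSpace.exists_mem_affPencils_zero_iff hH θ hθ) fun a A => mem_iff_of_eq_diff a (hθ A))
    | succ k =>
      obtain ⟨σ, h⟩ := exists_scheme_affCol k m hkm
      refine ⟨σ, fun Q 𝔔 H hm hH => ?_⟩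
      obtain ⟨θ, hθ⟩ := PolarSpace.exists_equiv_affSub (k + 1) hH
      exact (σ.defines_iff _ _ _).2 ((h Q 𝔔 H hm hH).of_equiv θ
        (PolarSpace.exists_mem_affPencils_iff hH θ hθ) fun a A => mem_iff_of_eq_diff a (hθ A))
  · obtain ⟨σ, h⟩ := exists_scheme_affColExt k m hkm
    refine ⟨σ, fun Q 𝔔 H hm hH => ?_⟩
    obtain ⟨θ, hθ⟩ := PolarSpace.exists_equiv_affSub k hH
    exact (σ.defines_iff _ _ _).2 ((h Q 𝔔 H hm hH).of_equiv θ
      (PolarSpace.exists_mem_affPencilsExt_iff hH θ hθ) fun a A => mem_iff_of_eq_diff a (hθ A))
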